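/- Let $d\ge 10$ be an integer and let $\mathbb T$ be an infinite $d$-regular tree (every vertex has exactly $d$ neighbours) with vertex set $\mathbb V$ and a distinguished root $0\in\mathbb V$. Let $A$ be the adjacency operator of $\mathbb T$ on $\ell^2(\mathbb V)$, $(A\psi)(v)=\sum_{w\sim v}\psi(w)$, let $(g_v)_{v\in\mathbb V}$ be i.i.d. real Gaussian random variables with mean zero and variance one, and let $V$ be the multiplication operator $(V\psi)(v)=g_v\psi(v)$ with domain $\{\psi\in\ell^2(\mathbb V):\sum_v g_v^2|\psi(v)|^2<\infty\}$. For $t>0$ let $H=-tA+V$, an (unbounded) self-adjoint operator on the domain of $V$, and for $z\in\mathbb C$ with $\operatorname{Im}z>0$ let $R(z)=(H-z)^{-1}$ and $R_{00}(z)=\langle\delta_0,R(z)\delta_0\rangle$. Fix $E\in\mathbb R$ and $t>0$, and suppose that there exists $c>0$ such that $$\liminf_{\eta\to0^+}\ \mathbb P\bigl(\operatorname{Im}R_{00}(E+\mathrm i\eta)>c\bigr)>c .$$ Then $$\sup_{\eta\in(0,1]}\ \mathbb E\Bigl[\bigl(\operatorname{Im}R_{00}(E+\mathrm i\eta)\bigr)^2\Bigr]<\infty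 .$$ -/

import Mathlib

open scoped InnerProductSpace ENNReal Topology
open MeasureTheory ProbabilityTheory

namespace TreeAnderson

/-- The complex Hilbert space `ℓ²(V)`. -/
abbrev Ell2 (V : Type*) : Type _ := lp (fun _ : V => ℂ) 2

section Adjacency

variable {V : Type*} (G : SimpleGraph V) [G.LocallyFinite]

theorem adjacency_memℓp {d : ℕ} (hG : ∀ v, G.degree v ≤ d) (ψ : Ell2 V) :
    Memℓp (fun v => ∑ w ∈ G.neighborFinset v, ψ w) 2 ∧
      ∀ s : Finset V, ∑ v ∈ s, ‖∑ w ∈ G.neighborFinset v, ψ w‖ ^ 2 ≤ (d * ‖ψ‖) ^ 2 := by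
  classical
  have key : ∀ s : Finset V,
      ∑ v ∈ s, ‖∑ w ∈ G.neighborFinset v, ψ w‖ ^ 2 ≤ (d * ‖ψ‖) ^ 2 := by
    intro s
    have h1 : ∀ v, ‖∑ w ∈ G.neighborFinset v, ψ w‖ ^ 2
        ≤ d * ∑ w ∈ G.neighborFinset v, ‖ψ w‖ ^ 2 := by
      intro v
      calc ‖∑ w ∈ G.neighborFinset v, ψ w‖ ^ 2
          ≤ (∑ w ∈ G.neighborFinset v, ‖ψ w‖) ^ 2 := by
            gcongr; exact norm_sum_le _ _
        _ ≤ (G.neighborFinset v).card * ∑ w ∈ G.neighborFinset v, ‖ψ w‖ ^ 2 :=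
            sq_sum_le_card_mul_sum_sq
        _ ≤ d * ∑ w ∈ G.neighborFinset v, ‖ψ w‖ ^ 2 := by
            gcongr; exact hG v
    let u := s.biUnion fun v => G.neighborFinset v
    have h2 : ∑ v ∈ s, ∑ w ∈ G.neighborFinset v, ‖ψ w‖ ^ 2 ≤ d * ∑ w ∈ u, ‖ψ w‖ ^ 2 := by
      rw [Finset.sum_comm' (t' := u) (s' := fun w => s ∩ G.neighborFinset w)]
      · rw [Finset.mul_sum]
        refine Finset.sum_le_sum fun w _ => ?_
        rw [Finset.sum_const, nsmul_eq_mul]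
        gcongr
        exact (Finset.card_le_card Finset.inter_subset_right).trans (hG w)
      · intro v w
        simp only [u, Finset.mem_biUnion, Finset.mem_inter, SimpleGraph.mem_neighborFinset]
        constructor
        · rintro ⟨hv, hvw⟩
          exact ⟨⟨hv, hvw.symm⟩, v, hv, hvw⟩
        · rintro ⟨⟨hv, hvw⟩, -⟩
          exact ⟨hv, hvw.symm⟩
    have h3 : ∑ w ∈ u, ‖ψ w‖ ^ 2 ≤ ‖ψ‖ ^ 2 := by
      simpa using lp.sum_rpow_le_norm_rpow (p := 2) (by norm_num) ψ u
    calc ∑ v ∈ s, ‖∑ w ∈ G.neighborFinset v, ψ w‖ ^ 2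
        ≤ ∑ v ∈ s, d * ∑ w ∈ G.neighborFinset v, ‖ψ w‖ ^ 2 := Finset.sum_le_sum fun v _ => h1 v
      _ = d * ∑ v ∈ s, ∑ w ∈ G.neighborFinset v, ‖ψ w‖ ^ 2 := by rw [Finset.mul_sum]
      _ ≤ d * (d * ‖ψ‖ ^ 2) := by gcongr; exact h2.trans (by gcongr)
      _ = (d * ‖ψ‖) ^ 2 := by ring
  refine ⟨memℓp_gen' (C := (d * ‖ψ‖) ^ 2) fun s => ?_, key⟩
  simpa using key s

/-- The adjacency operator `(A ψ) v = ∑_{w ∼ v} ψ w` on `ℓ²(V)`, a bounded operator for a graph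
with bounded degrees. -/
noncomputable def adjacencyOp {d : ℕ} (hG : ∀ v, G.degree v ≤ d) : Ell2 V →L[ℂ] Ell2 V :=
  LinearMap.mkContinuous
    { toFun := fun ψ => ⟨fun v => ∑ w ∈ G.neighborFinset v, ψ w, (adjacency_memℓp G hG ψ).1⟩
      map_add' := fun φ ψ => by
        ext v
        exact Finset.sum_add_distrib
      map_smul' := fun c ψ => by
        ext v
        simp [Finset.mul_sum] }
    d
    (fun ψ => by
      refine lp.norm_le_of_forall_sum_le (by norm_num) (by positivity) fun s => ?_
      simpa using (adjacency_memℓp G hG ψ).2 s)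

end Adjacency

section Potential

variable {V : Type*}

/-- The diagonal operator with real diagonal `q`, as an unbounded operator on `ℓ²(V)` with its
maximal domain `{ψ ∈ ℓ²(V) : ∑ |q v|² |ψ v|² < ∞}`. -/
noncomputable def potentialOp (q : V → ℝ) : Ell2 V →ₗ.[ℂ] Ell2 V where
  domain :=
    { carrier := {ψ | Memℓp (fun v => (q v : ℂ) * ψ v) 2}
      add_mem' := fun {φ ψ} hφ hψ => by
        have h : (fun v => (q v : ℂ) * (φ + ψ) v)
            = (fun v => (q v : ℂ) * φ v) + fun v => (q v : ℂ) * ψ v := by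
          funext v
          exact mul_add _ _ _
        rw [Set.mem_ofPred_eq, h]
        exact Memℓp.add hφ hψ
      zero_mem' := by
        have h : (fun v => (q v : ℂ) * (0 : Ell2 V) v) = 0 := by
          funext v
          exact mul_zero _
        rw [Set.mem_ofPred_eq, h]
        exact zero_memℓp
      smul_mem' := fun c ψ hψ => by
        have h : (fun v => (q v : ℂ) * (c • ψ) v) = fun v => c * ((q v : ℂ) * ψ v) := by
          funext v
          exact mul_left_comm _ _ _
        rw [Set.mem_ofPred_eq, h]
        exact Memℓp.const_mul hψ c }
  toFun :=
    { toFun := fun ψ => ⟨fun v => (q v : ℂ) * (ψ : Ell2 V) v, ψ.2⟩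
      map_add' := fun φ ψ => by
        ext v
        exact mul_add _ _ _
      map_smul' := fun c ψ => by
        ext v
        exact mul_left_comm _ _ _ }

/-- The Anderson Hamiltonian `H = -t A + q` on `ℓ²(V)`, with the domain of the potential `q`. -/
noncomputable def hamiltonian (G : SimpleGraph V) [G.LocallyFinite] {d : ℕ}
    (hG : ∀ v, G.degree v ≤ d) (t : ℝ) (q : V → ℝ) : Ell2 V →ₗ.[ℂ] Ell2 V :=
  ((-(t : ℂ)) • (adjacencyOp G hG : Ell2 V →ₗ[ℂ] Ell2 V)) +ᵥ potentialOp q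

end Potential

section Resolvent

variable {E : Type*} [NormedAddCommGroup E] [NormedSpace ℂ E]

/-- `R` is a bounded two-sided inverse of `T - z`. -/
structure IsResolventAt (T : E →ₗ.[ℂ] E) (z : ℂ) (R : E →L[ℂ] E) : Prop where
  mem_domain : ∀ ψ, R ψ ∈ T.domain
  right_inv : ∀ ψ, T ⟨R ψ, mem_domain ψ⟩ - z • R ψ = ψ
  left_inv : ∀ φ : T.domain, R (T φ - z • (φ : E)) = φ

theorem IsResolventAt.unique {T : E →ₗ.[ℂ] E} {z : ℂ} {R R' : E →L[ℂ] E}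
    (h : IsResolventAt T z R) (h' : IsResolventAt T z R') : R = R' := by
  ext ψ
  have := h'.left_inv ⟨R ψ, h.mem_domain ψ⟩
  rw [h.right_inv ψ] at this
  exact this.symm

open Classical in
/-- The resolvent `(T - z)⁻¹` of an unbounded operator `T`, a bounded operator (by convention `0`
if `z` belongs to the spectrum of `T`). -/
noncomputable def resolventOp (T : E →ₗ.[ℂ] E) (z : ℂ) : E →L[ℂ] E :=
  if h : ∃ R, IsResolventAt T z R then h.choose else 0

theorem IsResolventAt.resolventOp_eq {T : E →ₗ.[ℂ] E} {z : ℂ} {R : E →L[ℂ] E}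
    (h : IsResolventAt T z R) : resolventOp T z = R := by
  have hex : ∃ R, IsResolventAt T z R := ⟨R, h⟩
  rw [resolventOp, dif_pos hex]
  exact hex.choose_spec.unique h

end Resolvent

section Existence

variable {V : Type*}

theorem IsResolventAt.perturb {E : Type*} [NormedAddCommGroup E] [NormedSpace ℂ E]
    [CompleteSpace E] {T : E →ₗ.[ℂ] E} {z₀ : ℂ} {R : E →L[ℂ] E} (h : IsResolventAt T z₀ R)
    (B : E →L[ℂ] E) (z : ℂ) (hz : ‖(B - (z - z₀) • (1 : E →L[ℂ] E)) * R‖ < 1) :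
    ∃ R', IsResolventAt ((B : E →ₗ[ℂ] E) +ᵥ T) z R' := by
  obtain ⟨U, hU⟩ : IsUnit (1 + (B - (z - z₀) • (1 : E →L[ℂ] E)) * R) := by
    have := isUnit_one_sub_of_norm_lt_one (x := -((B - (z - z₀) • (1 : E →L[ℂ] E)) * R))
      (by rwa [norm_neg])
    rwa [sub_neg_eq_add] at this
  have hUapp : ∀ ψ, (U : E →L[ℂ] E) ψ = ψ + (B (R ψ) - (z - z₀) • R ψ) := by
    intro ψ
    rw [hU]
    rfl
  have hUi : ∀ ψ, (U : E →L[ℂ] E) ((↑U⁻¹ : E →L[ℂ] E) ψ) = ψ := by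
    intro ψ
    rw [← mul_apply_eq_comp, Units.mul_inv]
    rfl
  have hiU : ∀ ψ, (↑U⁻¹ : E →L[ℂ] E) ((U : E →L[ℂ] E) ψ) = ψ := by
    intro ψ
    rw [← mul_apply_eq_comp, Units.inv_mul]
    rfl
  refine ⟨R * ↑U⁻¹, ⟨fun ψ => h.mem_domain _, fun ψ => ?_, fun φ => ?_⟩⟩
  · have h1 := h.right_inv ((↑U⁻¹ : E →L[ℂ] E) ψ)
    have h2 := hUi ψ
    rw [hUapp] at h2
    rw [LinearPMap.vadd_apply]
    change B (R ((↑U⁻¹ : E →L[ℂ] E) ψ)) + T ⟨R ((↑U⁻¹ : E →L[ℂ] E) ψ), h.mem_domain _⟩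
      - z • R ((↑U⁻¹ : E →L[ℂ] E) ψ) = ψ
    rw [sub_eq_iff_eq_add] at h1
    rw [h1]
    refine Eq.trans ?_ h2
    module
  · have h1 := h.left_inv φ
    have h2 : ((B : E →ₗ[ℂ] E) +ᵥ T) φ - z • (φ : E)
        = (U : E →L[ℂ] E) (T φ - z₀ • (φ : E)) := by
      rw [hUapp, h1, LinearPMap.vadd_apply]
      change B (φ : E) + T φ - z • (φ : E) = _
      module
    rw [h2, mul_apply_eq_comp, hiU]
    exact h1

theorem exists_isResolventAt_potentialOp (q : V → ℝ) {z : ℂ} (hz : 0 < z.im) :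
    ∃ R, IsResolventAt (potentialOp q) z R ∧ ‖R‖ ≤ z.im⁻¹ := by
  have hne : ∀ v, (q v : ℂ) - z ≠ 0 := by
    intro v h
    have := congrArg Complex.im h
    simp at this
    exact hz.ne' this
  have hb : ∀ v, ‖((q v : ℂ) - z)⁻¹‖ ≤ z.im⁻¹ := by
    intro v
    rw [norm_inv]
    refine inv_anti₀ hz ?_
    have := Complex.abs_im_le_norm ((q v : ℂ) - z)
    simp only [Complex.sub_im, Complex.ofReal_im, zero_sub, abs_neg] at this
    exact (le_abs_self _).trans this
  have hsum : ∀ ψ : Ell2 V, ∀ s : Finset V,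
      ∑ v ∈ s, ‖((q v : ℂ) - z)⁻¹ * ψ v‖ ^ 2 ≤ (z.im⁻¹ * ‖ψ‖) ^ 2 := by
    intro ψ s
    have h3 : ∑ w ∈ s, ‖ψ w‖ ^ 2 ≤ ‖ψ‖ ^ 2 := by
      simpa using lp.sum_rpow_le_norm_rpow (p := 2) (by norm_num) ψ s
    calc ∑ v ∈ s, ‖((q v : ℂ) - z)⁻¹ * ψ v‖ ^ 2
        ≤ ∑ v ∈ s, z.im⁻¹ ^ 2 * ‖ψ v‖ ^ 2 := by
          refine Finset.sum_le_sum fun v _ => ?_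
          rw [norm_mul, mul_pow]
          gcongr
          exact hb v
      _ = z.im⁻¹ ^ 2 * ∑ v ∈ s, ‖ψ v‖ ^ 2 := by rw [Finset.mul_sum]
      _ ≤ (z.im⁻¹ * ‖ψ‖) ^ 2 := by rw [mul_pow]; gcongr
  have hmem : ∀ ψ : Ell2 V, Memℓp (fun v => ((q v : ℂ) - z)⁻¹ * ψ v) 2 := fun ψ =>
    memℓp_gen' (C := (z.im⁻¹ * ‖ψ‖) ^ 2) fun s => by simpa using hsum ψ s
  let R : Ell2 V →L[ℂ] Ell2 V := LinearMap.mkContinuous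
    { toFun := fun ψ => ⟨fun v => ((q v : ℂ) - z)⁻¹ * ψ v, hmem ψ⟩
      map_add' := fun φ ψ => by
        ext v
        exact mul_add _ _ _
      map_smul' := fun c ψ => by
        ext v
        exact mul_left_comm _ _ _ }
    z.im⁻¹
    (fun ψ => by
      refine lp.norm_le_of_forall_sum_le (by norm_num) (by positivity) fun s => ?_
      simpa using hsum ψ s)
  have hR : ∀ ψ v, R ψ v = ((q v : ℂ) - z)⁻¹ * ψ v := fun _ _ => rfl
  have hdom : ∀ ψ, R ψ ∈ (potentialOp q).domain := by
    intro ψ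
    change Memℓp (fun v => (q v : ℂ) * R ψ v) 2
    have h : (fun v => (q v : ℂ) * R ψ v) = (ψ : V → ℂ) + fun v => z * R ψ v := by
      funext v
      simp only [Pi.add_apply, hR]
      field_simp [hne v]
      ring
    rw [h]
    exact Memℓp.add (lp.memℓp ψ) (Memℓp.const_mul (lp.memℓp (R ψ)) z)
  refine ⟨R, ⟨hdom, fun ψ => ?_, fun φ => ?_⟩, LinearMap.mkContinuous_norm_le _ (by positivity) _⟩
  · ext v
    change (q v : ℂ) * R ψ v - z * R ψ v = ψ v
    rw [hR, ← sub_mul, mul_inv_cancel_left₀ (hne v)]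
  · ext v
    change ((q v : ℂ) - z)⁻¹ * ((q v : ℂ) * (φ : Ell2 V) v - z * (φ : Ell2 V) v) = (φ : Ell2 V) v
    rw [← sub_mul, inv_mul_cancel_left₀ (hne v)]

theorem inner_adjacencyOp (G : SimpleGraph V) [G.LocallyFinite] {d : ℕ}
    (hG : ∀ v, G.degree v ≤ d) (φ ψ : Ell2 V) :
    ⟪φ, adjacencyOp G hG ψ⟫_ℂ = ⟪adjacencyOp G hG φ, ψ⟫_ℂ := by
  classical
  have happ : ∀ (ψ : Ell2 V) v, adjacencyOp G hG ψ v = ∑ w ∈ G.neighborFinset v, ψ w :=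
    fun _ _ => rfl
  rw [← ContinuousLinearMap.adjoint_inner_left]
  congr 1
  suffices h : ContinuousLinearMap.adjoint (adjacencyOp G hG) = adjacencyOp G hG by rw [h]
  refine lp.ext_continuousLinearMap (by norm_num) fun w => ?_
  ext v
  have h1 : ∀ χ : Ell2 V, χ v = ⟪(lp.single 2 v 1 : Ell2 V), χ⟫_ℂ := fun χ => by
    rw [lp.inner_single_left]
    simp
  simp only [ContinuousLinearMap.comp_apply, lp.singleContinuousLinearMap_apply]
  rw [h1, ContinuousLinearMap.adjoint_inner_right, lp.inner_single_right, happ, happ]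
  simp [Pi.single_apply, Finset.sum_ite_eq', SimpleGraph.adj_comm]

theorem norm_hamiltonian_sub_ge (G : SimpleGraph V) [G.LocallyFinite] {d : ℕ}
    (hG : ∀ v, G.degree v ≤ d) (t : ℝ) (q : V → ℝ) (z : ℂ)
    (φ : (hamiltonian G hG t q).domain) :
    z.im * ‖(φ : Ell2 V)‖ ≤ ‖hamiltonian G hG t q φ - z • (φ : Ell2 V)‖ := by
  have hA : (⟪(φ : Ell2 V), adjacencyOp G hG φ⟫_ℂ).im = 0 := by
    rw [← Complex.conj_eq_iff_im, inner_conj_symm, inner_adjacencyOp]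
  have hV : (⟪(φ : Ell2 V), potentialOp q φ⟫_ℂ).im = 0 := by
    rw [← Complex.conj_eq_iff_im, inner_conj_symm, lp.inner_eq_tsum, lp.inner_eq_tsum]
    congr 1
    funext v
    change ⟪(q v : ℂ) * (φ : Ell2 V) v, (φ : Ell2 V) v⟫_ℂ
      = ⟪(φ : Ell2 V) v, (q v : ℂ) * (φ : Ell2 V) v⟫_ℂ
    simp only [RCLike.inner_apply, map_mul, Complex.conj_ofReal]
    ring
  have hH : hamiltonian G hG t q φ = -(t : ℂ) • adjacencyOp G hG φ + potentialOp q φ := rfl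
  have him : (⟪(φ : Ell2 V), hamiltonian G hG t q φ - z • (φ : Ell2 V)⟫_ℂ).im
      = -(z.im * ‖(φ : Ell2 V)‖ ^ 2) := by
    rw [hH, inner_sub_right, inner_add_right, inner_smul_right, inner_smul_right,
      inner_self_eq_norm_sq_to_K]
    have : (((‖(φ : Ell2 V)‖ : ℝ) : ℂ) ^ 2) = ((‖(φ : Ell2 V)‖ ^ 2 : ℝ) : ℂ) := by push_cast; rfl
    simp only [Complex.sub_im, Complex.add_im, Complex.mul_im, hA, hV, Complex.neg_re,
      Complex.neg_im, Complex.ofReal_im, Complex.coe_algebraMap, this, Complex.ofReal_re]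
    ring
  have hle := (Complex.abs_im_le_norm _).trans
    (norm_inner_le_norm (𝕜 := ℂ) (φ : Ell2 V) (hamiltonian G hG t q φ - z • (φ : Ell2 V)))
  rw [him, abs_neg] at hle
  rcases (norm_nonneg (φ : Ell2 V)).eq_or_lt with h0 | h0
  · rw [← h0, mul_zero]
    exact norm_nonneg _
  · refine le_of_mul_le_mul_left ?_ h0
    calc ‖(φ : Ell2 V)‖ * (z.im * ‖(φ : Ell2 V)‖) = z.im * ‖(φ : Ell2 V)‖ ^ 2 := by ring
      _ ≤ _ := (le_abs_self _).trans hle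

/-- The upper half plane belongs to the resolvent set of `H`, so that the value of the resolvent
there is never the conventional one. -/
theorem isResolventAt_hamiltonian (G : SimpleGraph V) [G.LocallyFinite] {d : ℕ}
    (hG : ∀ v, G.degree v ≤ d) (t : ℝ) (q : V → ℝ) {z : ℂ} (hz : 0 < z.im) :
    IsResolventAt (hamiltonian G hG t q) z (resolventOp (hamiltonian G hG t q) z) := by
  suffices h : ∃ R, IsResolventAt (hamiltonian G hG t q) z R by
    obtain ⟨R, hR⟩ := h
    rwa [hR.resolventOp_eq]
  set B : Ell2 V →L[ℂ] Ell2 V := (-(t : ℂ)) • adjacencyOp G hG with hB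
  obtain ⟨s, hs⟩ : ∃ s : ℝ, max ‖B‖ z.im < s := exists_gt _
  have hsB : ‖B‖ < s := (le_max_left _ _).trans_lt hs
  have hsz : z.im < s := (le_max_right _ _).trans_lt hs
  have hs0 : 0 < s := hz.trans hsz
  let z₀ : ℂ := ⟨z.re, s⟩
  obtain ⟨D, hD, hDn⟩ := exists_isResolventAt_potentialOp q (z := z₀) hs0
  obtain ⟨R₀, hR₀⟩ := hD.perturb B z₀ (by
    rw [sub_self, zero_smul, sub_zero]
    calc ‖B * D‖ ≤ ‖B‖ * ‖D‖ := norm_mul_le _ _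
      _ ≤ ‖B‖ * s⁻¹ := by gcongr
      _ < s * s⁻¹ := by gcongr
      _ = 1 := mul_inv_cancel₀ hs0.ne')
  have hR₀' : IsResolventAt (hamiltonian G hG t q) z₀ R₀ := hR₀
  have hn : ‖R₀‖ ≤ s⁻¹ := by
    refine ContinuousLinearMap.opNorm_le_bound _ (by positivity) fun ψ => ?_
    have h1 := norm_hamiltonian_sub_ge G hG t q z₀ ⟨R₀ ψ, hR₀'.mem_domain ψ⟩
    have h2 := hR₀'.right_inv ψ
    rw [h2] at h1
    rw [inv_mul_eq_div, le_div_iff₀' hs0]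
    exact h1
  have hzz : z - z₀ = ((z.im - s : ℝ) : ℂ) * Complex.I := by
    apply Complex.ext <;> simp [z₀]
  obtain ⟨R, hR⟩ := hR₀'.perturb 0 z (by
    rw [zero_sub, neg_mul, norm_neg, smul_mul_assoc, one_mul, norm_smul, hzz, norm_mul,
      Complex.norm_I, mul_one, Complex.norm_real, Real.norm_eq_abs, abs_of_neg (by linarith)]
    calc -(z.im - s) * ‖R₀‖ ≤ -(z.im - s) * s⁻¹ := by
          gcongr
          linarith
      _ < s * s⁻¹ := by
          gcongr
          linarith
      _ = 1 := mul_inv_cancel₀ hs0.ne')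
  refine ⟨R, ?_⟩
  have h0 : ((0 : Ell2 V →L[ℂ] Ell2 V) : Ell2 V →ₗ[ℂ] Ell2 V) +ᵥ hamiltonian G hG t q
      = hamiltonian G hG t q := zero_vadd _ _
  rwa [h0] at hR

end Existence

open Classical in
/-- The entry `R_{oo}(z) = ⟨δ_o, (H - z)⁻¹ δ_o⟩` of the resolvent of the Anderson Hamiltonian
`H = -t A + q`. -/
noncomputable def resolventEntry {V : Type*} (G : SimpleGraph V) [G.LocallyFinite] {d : ℕ}
    (hG : ∀ v, G.degree v ≤ d) (t : ℝ) (q : V → ℝ) (o : V) (z : ℂ) : ℂ :=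
  ⟪(lp.single 2 o 1 : Ell2 V),
    resolventOp (hamiltonian G hG t q) z (lp.single 2 o 1 : Ell2 V)⟫_ℂ

end TreeAnderson

/-!
The diagonal resolvent entry of the Anderson Hamiltonian on a tree is the value `Γ o o` of a family
`Γ u v` of branch Green functions, which solves the recursion
`Γ u v = (g v - S u v)⁻¹`, `S u v = z + t² ∑ Γ v w`, the sum being over the neighbours `w ≠ u` of
`v`. Here `Γ u v` belongs to the branch that starts at `v` and avoids `u`, so that for fixed `v` the
variables `Γ v w` are independent of each other and of `g v`, and all of them have the same law.

*Construction of `Γ`.* Iterating the recursion contracts the hyperbolic distance of the upper half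
plane, uniformly in the potential: inversion is an isometry, sums do not increase distances, and
adding `i Im z` strictly decreases distances in a strip of bounded height
(`exists_norm_iterate_sub_le`). The limit `branchGreen` is therefore measurable with respect to the
potential on the branch, and its law does not depend on the branch (`identDistrib_branchGreen`).
Products of its values along paths form a solution `ψ` of `(H - z) ψ = δ_o`, and conservation of
current shows that `ψ` is square summable; so `ψ` is the column of the resolvent
(`resolventEntry_eq_branchGreen`).

*Reduction to an inverse moment.* The law of `g o` has a density bounded by one, and
`∫ (Im (x - S)⁻¹)² dx ≤ π / Im S`. As `Im S` is at least `t² Im Γ o w` for every neighbour `w`, four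
neighbours give `𝔼 (Im Γ o o)² ≤ π t⁻² m⁴` with `m = 𝔼 (Im Γ)^(-1/4)` (`lintegral_im_sq_le`).

*Bound on the inverse moment.* From `Im Γ = Im S / |g - S|²` one has
`(Im Γ)^(-1/4) = |g - S|^(1/2) (Im S)^(-1/4)`. The first factor splits into contributions of `g`, of
`z`, and of single branches, each with a bounded moment; for each of them two other branches are
available to bound the second factor, and only if one of these has `Im Γ < ε` is the other one
needed. Hence `m ≤ C (ε^(-1/4) + ℙ(Im Γ < ε) m)` (`lintegral_invRoot_le`), which bounds `m` as soon as
`ℙ(Im Γ < ε)` is small, uniformly in `η`. This follows from the hypothesis in two steps. The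
hypothesis transfers from the root to the branches, `ℙ(Im Γ < ε₀) ≤ 1 - c / (2 d)`
(`measure_im_lt_le_of_root`). And since a small `Im Γ` requires small values at two independent
children or a large `|g - S|`, the limit `q` of `sup_η ℙ(Im Γ < ε)` as `ε → 0` satisfies `q ≤ q²`, so
that `q = 0` (`measure_im_lt_le`, `exists_lt_of_le_sq`).
-/

namespace TreeAnderson

/-! ### The recursion for the Green functions of the branches -/

section Recursion

variable {V : Type*} (T : SimpleGraph V) [T.LocallyFinite]

open Classical in
/-- The neighbours of `v` other than `u`. -/
noncomputable def children (u v : V) : Finset V := (T.neighborFinset v).erase u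

theorem mem_children {u v w : V} : w ∈ children T u v ↔ w ≠ u ∧ T.Adj v w := by
  simp [children]

theorem card_children_le {d : ℕ} (hG : ∀ v, T.degree v ≤ d) (u v : V) :
    (children T u v).card ≤ d := by
  classical
  exact (Finset.card_erase_le).trans (hG v)

/-- One step of the Schur complement recursion for the Green functions of the branches. It is
defined for all pairs, and `u = v` stands for the whole tree seen from `v`, as then no neighbour is
removed. -/
noncomputable def branchStep (t : ℝ) (z : ℂ) (q : V → ℝ) (Γ : V → V → ℂ) (u v : V) : ℂ :=
  ((q v : ℂ) - (z + (t : ℂ) ^ 2 * ∑ w ∈ children T u v, Γ v w))⁻¹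

/-- `Γ` takes values in the closed upper half plane and is bounded by `η⁻¹`. -/
def Admissible (η : ℝ) (Γ : V → V → ℂ) : Prop :=
  ∀ u v, 0 ≤ (Γ u v).im ∧ ‖Γ u v‖ ≤ η⁻¹

variable {T}

theorem im_ofReal_sub_inv (q : ℝ) (s : ℂ) :
    (((q : ℂ) - s)⁻¹).im = s.im * ‖((q : ℂ) - s)⁻¹‖ ^ 2 := by
  rw [Complex.inv_im, norm_inv, inv_pow, ← Complex.normSq_eq_norm_sq]
  simp [div_eq_mul_inv]

theorem ofReal_sub_ne_zero (q : ℝ) {s : ℂ} (hs : 0 < s.im) : (q : ℂ) - s ≠ 0 := by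
  intro h
  have := congrArg Complex.im h
  simp at this
  exact hs.ne' this

theorem norm_ofReal_sub_inv_le (q : ℝ) {s : ℂ} (hs : 0 < s.im) :
    ‖((q : ℂ) - s)⁻¹‖ ≤ s.im⁻¹ := by
  rw [norm_inv]
  refine inv_anti₀ hs ?_
  have := Complex.abs_im_le_norm ((q : ℂ) - s)
  simp only [Complex.sub_im, Complex.ofReal_im, zero_sub, abs_neg] at this
  exact (le_abs_self _).trans this

theorem im_self_energy (t : ℝ) (z : ℂ) (Γ : V → ℂ) (s : Finset V) :
    (z + (t : ℂ) ^ 2 * ∑ w ∈ s, Γ w).im = z.im + t ^ 2 * ∑ w ∈ s, (Γ w).im := by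
  rw [← Complex.ofReal_pow, Complex.add_im, Complex.im_ofReal_mul, Complex.im_sum]

theorem im_le_im_self_energy (t : ℝ) (z : ℂ) {Γ : V → ℂ} {s : Finset V}
    (h : ∀ w ∈ s, 0 ≤ (Γ w).im) : z.im ≤ (z + (t : ℂ) ^ 2 * ∑ w ∈ s, Γ w).im := by
  rw [im_self_energy]
  have := Finset.sum_nonneg h
  nlinarith [sq_nonneg t, mul_nonneg (sq_nonneg t) this]

theorem Admissible.branchStep {t : ℝ} {z : ℂ} {q : V → ℝ} {Γ : V → V → ℂ} (hz : 0 < z.im)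
    (h : Admissible z.im Γ) : Admissible z.im (branchStep T t z q Γ) := by
  intro u v
  have h1 := im_le_im_self_energy t z (Γ := Γ v) (s := children T u v) fun w _ => (h v w).1
  constructor
  · rw [TreeAnderson.branchStep, im_ofReal_sub_inv]
    have := hz.trans_le h1
    positivity
  · exact (norm_ofReal_sub_inv_le _ (hz.trans_le h1)).trans (inv_anti₀ hz h1)

theorem admissible_zero {η : ℝ} (hη : 0 < η) : Admissible η (0 : V → V → ℂ) := by
  intro u v
  simp [hη.le]

theorem Admissible.iterate {t : ℝ} {z : ℂ} {q : V → ℝ} {Γ : V → V → ℂ} (hz : 0 < z.im)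
    (h : Admissible z.im Γ) (n : ℕ) : Admissible z.im ((TreeAnderson.branchStep T t z q)^[n] Γ) := by
  induction n with
  | zero => exact h
  | succ n ih =>
    rw [Function.iterate_succ_apply']
    exact ih.branchStep hz

/-- The hyperbolic distance of the values of `Γ` and `Γ'` is bounded: for `x`, `y` in the upper
half plane, `|x - y|² / (Im x Im y) = 2 (cosh (dist x y) - 1)`. -/
def HypClose (k : ℝ) (Γ Γ' : V → V → ℂ) : Prop :=
  ∀ u v, ‖Γ u v - Γ' u v‖ ^ 2 ≤ k * ((Γ u v).im * (Γ' u v).im)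

/-- The map `s ↦ (q - s)⁻¹` is an isometry of the upper half plane. -/
theorem norm_sub_sq_ofReal_sub_inv (q : ℝ) {s s' : ℂ} (hs : 0 < s.im) (hs' : 0 < s'.im) :
    ‖((q : ℂ) - s)⁻¹ - ((q : ℂ) - s')⁻¹‖ ^ 2 * (s.im * s'.im) =
      ‖s - s'‖ ^ 2 * ((((q : ℂ) - s)⁻¹).im * (((q : ℂ) - s')⁻¹).im) := by
  have h := ofReal_sub_ne_zero q hs
  have h' := ofReal_sub_ne_zero q hs'
  have h1 : ((q : ℂ) - s)⁻¹ - ((q : ℂ) - s')⁻¹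
      = (s - s') * ((q : ℂ) - s)⁻¹ * ((q : ℂ) - s')⁻¹ := by
    field_simp
    ring
  rw [im_ofReal_sub_inv q s, im_ofReal_sub_inv q s', h1, norm_mul, norm_mul]
  ring

theorem sum_norm_le {d : ℕ} (hG : ∀ v, T.degree v ≤ d) {η : ℝ} {Γ : V → V → ℂ}
    (h : Admissible η Γ) (hη : 0 < η) (u v : V) :
    ∑ w ∈ children T u v, ‖Γ v w‖ ≤ d * η⁻¹ := by
  calc ∑ w ∈ children T u v, ‖Γ v w‖ ≤ ∑ w ∈ children T u v, η⁻¹ :=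
        Finset.sum_le_sum fun w _ => (h v w).2
    _ = (children T u v).card * η⁻¹ := by rw [Finset.sum_const, nsmul_eq_mul]
    _ ≤ d * η⁻¹ := by
        gcongr
        exact card_children_le T hG u v

/-- After one step any two admissible families are at bounded hyperbolic distance. -/
theorem hypClose_branchStep {d : ℕ} (hG : ∀ v, T.degree v ≤ d) {t : ℝ} {z : ℂ} {q : V → ℝ}
    {Γ Γ' : V → V → ℂ} (hz : 0 < z.im) (h : Admissible z.im Γ) (h' : Admissible z.im Γ') :
    HypClose ((2 * (t ^ 2 * (d * z.im⁻¹)) / z.im) ^ 2) (branchStep T t z q Γ)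
      (branchStep T t z q Γ') := by
  intro u v
  set s := z + (t : ℂ) ^ 2 * ∑ w ∈ children T u v, Γ v w with hs
  set s' := z + (t : ℂ) ^ 2 * ∑ w ∈ children T u v, Γ' v w with hs'
  have h1 : z.im ≤ s.im := im_le_im_self_energy t z fun w _ => (h v w).1
  have h1' : z.im ≤ s'.im := im_le_im_self_energy t z fun w _ => (h' v w).1
  have key := norm_sub_sq_ofReal_sub_inv (q v) (hz.trans_le h1) (hz.trans_le h1')
  have h2 : ‖s - s'‖ ≤ 2 * (t ^ 2 * (d * z.im⁻¹)) := by
    have e : s - s' = (t : ℂ) ^ 2 * ∑ w ∈ children T u v, Γ v w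
        - (t : ℂ) ^ 2 * ∑ w ∈ children T u v, Γ' v w := by
      rw [hs, hs']; ring
    have b : ∀ Γ : V → V → ℂ, Admissible z.im Γ →
        ‖(t : ℂ) ^ 2 * ∑ w ∈ children T u v, Γ v w‖ ≤ t ^ 2 * (d * z.im⁻¹) := by
      intro Γ h
      rw [norm_mul, norm_pow, Complex.norm_real, Real.norm_eq_abs, sq_abs]
      gcongr
      exact (norm_sum_le _ _).trans (sum_norm_le hG h hz u v)
    rw [e]
    refine (norm_sub_le _ _).trans ?_
    linarith [b Γ h, b Γ' h']
  have hA : Admissible z.im (branchStep T t z q Γ) := h.branchStep hz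
  have hA' : Admissible z.im (branchStep T t z q Γ') := h'.branchStep hz
  change ‖branchStep T t z q Γ u v - branchStep T t z q Γ' u v‖ ^ 2 * _
    = _ * ((branchStep T t z q Γ u v).im * (branchStep T t z q Γ' u v).im) at key
  have hm : 0 ≤ (branchStep T t z q Γ u v).im * (branchStep T t z q Γ' u v).im :=
    mul_nonneg (hA u v).1 (hA' u v).1
  have hzz : z.im ^ 2 ≤ s.im * s'.im := by nlinarith
  rw [div_pow, div_mul_eq_mul_div, le_div_iff₀ (by positivity)]
  calc _ ≤ ‖branchStep T t z q Γ u v - branchStep T t z q Γ' u v‖ ^ 2 * (s.im * s'.im) := by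
        gcongr
    _ ≤ _ := by
        rw [key]
        gcongr

/-- The sum of points of the upper half plane does not increase hyperbolic distances, and adding
`z` strictly decreases them. -/
theorem HypClose.branchStep {d : ℕ} (hG : ∀ v, T.degree v ≤ d) {t : ℝ} {z : ℂ} {q : V → ℝ}
    {Γ Γ' : V → V → ℂ} (hz : 0 < z.im) (h : Admissible z.im Γ) (h' : Admissible z.im Γ')
    {k : ℝ} (hk : 0 ≤ k) (hc : HypClose k Γ Γ') :
    HypClose (((t ^ 2 * (d * z.im⁻¹)) / (t ^ 2 * (d * z.im⁻¹) + z.im)) ^ 2 * k)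
      (TreeAnderson.branchStep T t z q Γ) (TreeAnderson.branchStep T t z q Γ') := by
  intro u v
  set s := z + (t : ℂ) ^ 2 * ∑ w ∈ children T u v, Γ v w with hs
  set s' := z + (t : ℂ) ^ 2 * ∑ w ∈ children T u v, Γ' v w with hs'
  have h1 : z.im ≤ s.im := im_le_im_self_energy t z fun w _ => (h v w).1
  have h1' : z.im ≤ s'.im := im_le_im_self_energy t z fun w _ => (h' v w).1
  have key := norm_sub_sq_ofReal_sub_inv (q v) (hz.trans_le h1) (hz.trans_le h1')
  set a := ∑ w ∈ children T u v, (Γ v w).im with ha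
  set a' := ∑ w ∈ children T u v, (Γ' v w).im with ha'
  have hsa : s.im = z.im + t ^ 2 * a := im_self_energy _ _ _ _
  have hsa' : s'.im = z.im + t ^ 2 * a' := im_self_energy _ _ _ _
  have ha0 : 0 ≤ a := Finset.sum_nonneg fun w _ => (h v w).1
  have ha0' : 0 ≤ a' := Finset.sum_nonneg fun w _ => (h' v w).1
  set Y := t ^ 2 * (d * z.im⁻¹) with hY
  have hY0 : 0 ≤ Y := by positivity
  have b : ∀ Γ : V → V → ℂ, Admissible z.im Γ →
      t ^ 2 * ∑ w ∈ children T u v, (Γ v w).im ≤ Y := by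
    intro Γ h
    rw [hY]
    gcongr
    refine (Finset.sum_le_sum fun w _ => ?_).trans (sum_norm_le hG h hz u v)
    exact (le_abs_self _).trans (Complex.abs_im_le_norm _)
  have hb := b Γ h
  have hb' := b Γ' h'
  rw [← ha] at hb
  rw [← ha'] at hb'
  have h2 : ‖s - s'‖ ^ 2 ≤ k * ((t ^ 2 * a) * (t ^ 2 * a')) := by
    have e : s - s' = (t : ℂ) ^ 2 * ∑ w ∈ children T u v, (Γ v w - Γ' v w) := by
      rw [hs, hs', Finset.sum_sub_distrib]; ring
    have e2 : ‖∑ w ∈ children T u v, (Γ v w - Γ' v w)‖ ^ 2 ≤ k * (a * a') := by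
      calc ‖∑ w ∈ children T u v, (Γ v w - Γ' v w)‖ ^ 2
          ≤ (∑ w ∈ children T u v, ‖Γ v w - Γ' v w‖) ^ 2 := by
            gcongr
            exact norm_sum_le _ _
        _ ≤ (∑ w ∈ children T u v, √k * (√(Γ v w).im * √(Γ' v w).im)) ^ 2 := by
            refine pow_le_pow_left₀ (Finset.sum_nonneg fun _ _ => norm_nonneg _)
              (Finset.sum_le_sum fun w _ => ?_) 2
            rw [← Real.sqrt_mul (h v w).1, ← Real.sqrt_mul hk]
            exact Real.le_sqrt_of_sq_le (hc v w)
        _ = k * (∑ w ∈ children T u v, √(Γ v w).im * √(Γ' v w).im) ^ 2 := by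
            rw [← Finset.mul_sum, mul_pow, Real.sq_sqrt hk]
        _ ≤ k * ((∑ w ∈ children T u v, √(Γ v w).im ^ 2)
              * ∑ w ∈ children T u v, √(Γ' v w).im ^ 2) := by
            gcongr
            exact Finset.sum_mul_sq_le_sq_mul_sq _ _ _
        _ = k * (a * a') := by
            rw [Finset.sum_congr rfl fun w _ => Real.sq_sqrt (h v w).1,
              Finset.sum_congr rfl fun w _ => Real.sq_sqrt (h' v w).1]
    rw [e, norm_mul, norm_pow, Complex.norm_real, Real.norm_eq_abs, sq_abs, mul_pow]
    calc (t ^ 2) ^ 2 * ‖∑ w ∈ children T u v, (Γ v w - Γ' v w)‖ ^ 2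
        ≤ (t ^ 2) ^ 2 * (k * (a * a')) := by gcongr
      _ = _ := by ring
  have hA : Admissible z.im (TreeAnderson.branchStep T t z q Γ) := h.branchStep hz
  have hA' : Admissible z.im (TreeAnderson.branchStep T t z q Γ') := h'.branchStep hz
  change ‖TreeAnderson.branchStep T t z q Γ u v - TreeAnderson.branchStep T t z q Γ' u v‖ ^ 2 * _
    = _ * ((TreeAnderson.branchStep T t z q Γ u v).im
      * (TreeAnderson.branchStep T t z q Γ' u v).im) at key
  have hm : 0 ≤ (TreeAnderson.branchStep T t z q Γ u v).im
      * (TreeAnderson.branchStep T t z q Γ' u v).im := mul_nonneg (hA u v).1 (hA' u v).1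
  have hr : ∀ x : ℝ, x ≤ Y → x ≤ Y / (Y + z.im) * (z.im + x) := by
    intro x hx
    rw [div_mul_eq_mul_div, le_div_iff₀ (by positivity)]
    nlinarith
  have hss : 0 < s.im * s'.im := mul_pos (hz.trans_le h1) (hz.trans_le h1')
  refine le_of_mul_le_mul_right ?_ hss
  rw [key]
  have h3 : (t ^ 2 * a) * (t ^ 2 * a') ≤ (Y / (Y + z.im)) ^ 2 * (s.im * s'.im) := by
    calc (t ^ 2 * a) * (t ^ 2 * a')
        ≤ (Y / (Y + z.im) * (z.im + t ^ 2 * a)) * (Y / (Y + z.im) * (z.im + t ^ 2 * a')) := by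
          exact mul_le_mul (hr _ hb) (hr _ hb') (by positivity) (by positivity)
      _ = _ := by rw [hsa, hsa']; ring
  calc ‖s - s'‖ ^ 2 * _ ≤ (k * ((Y / (Y + z.im)) ^ 2 * (s.im * s'.im))) * _ :=
        mul_le_mul_of_nonneg_right (h2.trans (by gcongr)) hm
    _ = _ := by ring

/-- Any two orbits of the recursion approach each other geometrically, uniformly in the
potential. -/
theorem exists_norm_iterate_sub_le {d : ℕ} (hG : ∀ v, T.degree v ≤ d) (t : ℝ) {z : ℂ}
    (hz : 0 < z.im) : ∃ C κ : ℝ, 0 ≤ κ ∧ κ < 1 ∧ ∀ (q : V → ℝ) (Γ Γ' : V → V → ℂ),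
      Admissible z.im Γ → Admissible z.im Γ' → ∀ n u v,
      ‖(branchStep T t z q)^[n + 1] Γ u v - (branchStep T t z q)^[n + 1] Γ' u v‖ ≤ C * κ ^ n := by
  set Y := t ^ 2 * (d * z.im⁻¹) with hY
  have hY0 : 0 ≤ Y := by positivity
  refine ⟨2 * Y / z.im * z.im⁻¹, Y / (Y + z.im), by positivity, ?_, ?_⟩
  · rw [div_lt_one (by positivity)]
    linarith
  intro q Γ Γ' h h' n u v
  have hc : ∀ n : ℕ, HypClose (((Y / (Y + z.im)) ^ n * (2 * Y / z.im)) ^ 2)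
      ((branchStep T t z q)^[n + 1] Γ) ((branchStep T t z q)^[n + 1] Γ') := by
    intro n
    induction n with
    | zero => simpa using hypClose_branchStep hG hz h h'
    | succ n ih =>
      rw [Function.iterate_succ_apply' _ (n + 1), Function.iterate_succ_apply' _ (n + 1)]
      have := HypClose.branchStep (q := q) (t := t) hG hz (h.iterate hz (n + 1))
        (h'.iterate hz (n + 1)) (sq_nonneg _) ih
      convert this using 1
      rw [← hY]
      ring
  have hA := h.iterate (T := T) (t := t) (q := q) hz (n + 1) u v
  have hA' := h'.iterate (T := T) (t := t) (q := q) hz (n + 1) u v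
  have h1 : ∀ {x : ℂ}, ‖x‖ ≤ z.im⁻¹ → x.im ≤ z.im⁻¹ := fun h =>
    (le_abs_self _).trans ((Complex.abs_im_le_norm _).trans h)
  refine le_of_sq_le_sq ?_ (by positivity)
  calc _ ≤ _ := hc n u v
    _ ≤ ((Y / (Y + z.im)) ^ n * (2 * Y / z.im)) ^ 2 * (z.im⁻¹ * z.im⁻¹) := by
        gcongr
        · exact hA'.1
        · exact h1 hA.2
        · exact h1 hA'.2
    _ = _ := by ring

variable (T) in
/-- The Green function at `v` of the branch of the tree that starts at `v` and avoids `u`, as the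
limit of the recursion; for `u = v` it is the Green function of the whole tree. -/
noncomputable def branchGreen (t : ℝ) (z : ℂ) (q : V → ℝ) (u v : V) : ℂ :=
  Filter.limUnder Filter.atTop fun n => (branchStep T t z q)^[n] 0 u v

theorem tendsto_branchGreen {d : ℕ} (hG : ∀ v, T.degree v ≤ d) (t : ℝ) {z : ℂ}
    (hz : 0 < z.im) (q : V → ℝ) (u v : V) :
    Filter.Tendsto (fun n => (branchStep T t z q)^[n] 0 u v) Filter.atTop
      (𝓝 (branchGreen T t z q u v)) := by
  obtain ⟨C, κ, hκ, hκ1, h⟩ := exists_norm_iterate_sub_le hG t hz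
  refine CauchySeq.tendsto_limUnder ?_
  rw [← cauchySeq_shift 1]
  refine cauchySeq_of_le_geometric κ C hκ1 fun n => ?_
  rw [dist_eq_norm, Function.iterate_succ_apply (branchStep T t z q) (n + 1)]
  exact h q _ _ (admissible_zero hz) ((admissible_zero hz).branchStep hz) n u v

theorem admissible_branchGreen {d : ℕ} (hG : ∀ v, T.degree v ≤ d) (t : ℝ) {z : ℂ}
    (hz : 0 < z.im) (q : V → ℝ) : Admissible z.im (branchGreen T t z q) := by
  intro u v
  have h := tendsto_branchGreen hG t hz q u v
  have hA := fun n => (admissible_zero hz).iterate (T := T) (t := t) (q := q) hz n u v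
  exact ⟨ge_of_tendsto' ((Complex.continuous_im.tendsto _).comp h) fun n => (hA n).1,
    le_of_tendsto' h.norm fun n => (hA n).2⟩

theorem branchGreen_eq {d : ℕ} (hG : ∀ v, T.degree v ≤ d) (t : ℝ) {z : ℂ}
    (hz : 0 < z.im) (q : V → ℝ) (u v : V) :
    branchGreen T t z q u v = ((q v : ℂ) -
      (z + (t : ℂ) ^ 2 * ∑ w ∈ children T u v, branchGreen T t z q v w))⁻¹ := by
  have h := (Filter.tendsto_add_atTop_iff_nat 1).2 (tendsto_branchGreen hG t hz q u v)
  refine tendsto_nhds_unique h ?_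
  simp only [Function.iterate_succ_apply']
  refine Filter.Tendsto.inv₀ ?_ ?_
  · refine tendsto_const_nhds.sub (tendsto_const_nhds.add (tendsto_const_nhds.mul ?_))
    exact tendsto_finsetSum _ fun w _ => tendsto_branchGreen hG t hz q v w
  · exact ofReal_sub_ne_zero _ (hz.trans_le (im_le_im_self_energy t z fun w _ =>
      (admissible_branchGreen hG t hz q v w).1))

end Recursion

/-! ### The Green function of the tree through its branches -/

section RootedTree

variable {V : Type*} {T : SimpleGraph V} (hT : T.IsTree)

/-- The path between two vertices of a tree. -/
noncomputable def treePath (v o : V) : T.Walk v o := (hT.existsUnique_path v o).choose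

theorem isPath_treePath (v o : V) : (treePath hT v o).IsPath :=
  (hT.existsUnique_path v o).choose_spec.1

theorem eq_treePath {v o : V} {p : T.Walk v o} (hp : p.IsPath) : p = treePath hT v o :=
  (hT.existsUnique_path v o).unique hp (isPath_treePath hT v o)

/-- The parent of `v` in the tree with root `o`; the root is its own parent. -/
noncomputable def parent (o v : V) : V := (treePath hT v o).snd

theorem treePath_self (o : V) : treePath hT o o = .nil :=
  (eq_treePath hT SimpleGraph.Walk.IsPath.nil).symm

theorem parent_root (o : V) : parent hT o o = o := by
  rw [parent, treePath_self]
  rfl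

theorem treePath_of_ne {o v : V} (hv : v ≠ o) :
    ∃ h : T.Adj v (parent hT o v), treePath hT v o = .cons h (treePath hT (parent hT o v) o) := by
  have hp := isPath_treePath hT v o
  have hpar : parent hT o v = (treePath hT v o).snd := rfl
  cases hc : treePath hT v o with
  | nil => exact absurd rfl hv
  | cons h p =>
    rw [hc] at hp hpar
    rw [SimpleGraph.Walk.snd_cons] at hpar
    rw [hpar]
    refine ⟨h, ?_⟩
    rw [← eq_treePath hT ((SimpleGraph.Walk.cons_isPath_iff _ _).1 hp).1]

theorem adj_parent {o v : V} (hv : v ≠ o) : T.Adj v (parent hT o v) :=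
  (treePath_of_ne hT hv).1

theorem parent_mem_support {o v x : V} (hx : x ∈ (treePath hT v o).support) :
    parent hT o x ∈ (treePath hT v o).support := by
  classical
  have h := eq_treePath hT ((isPath_treePath hT v o).dropUntil hx)
  refine SimpleGraph.Walk.support_dropUntil_subset_support _ hx ?_
  rw [h]
  exact SimpleGraph.Walk.getVert_mem_support _ _

/-- The product along a walk of `t Γ u v` over its steps from `v` to `u`, times the value `Γ v v` at
the endpoint of the walk. -/
noncomputable def walkWeight (t : ℝ) (Γ : V → V → ℂ) : {v o : V} → T.Walk v o → ℂ
  | v, _, .nil => Γ v v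
  | v, _, .cons (v := u) _ p => t * Γ u v * walkWeight t Γ p

/-- The column `v ↦ R_{vo}` of the resolvent, written as a product along the path from `v` to
`o`. -/
noncomputable def greenColumn (t : ℝ) (Γ : V → V → ℂ) (o v : V) : ℂ :=
  walkWeight t Γ (treePath hT v o)

theorem greenColumn_root (t : ℝ) (Γ : V → V → ℂ) (o : V) : greenColumn hT t Γ o o = Γ o o := by
  rw [greenColumn, treePath_self]
  rfl

variable [T.LocallyFinite]

theorem treePath_of_mem_children {o v w : V} (hw : w ∈ children T (parent hT o v) v) :
    ∃ h : T.Adj w v, treePath hT w o = .cons h (treePath hT v o) := by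
  rw [mem_children] at hw
  refine ⟨hw.2.symm, ?_⟩
  refine (eq_treePath hT ?_).symm
  rw [SimpleGraph.Walk.cons_isPath_iff]
  refine ⟨isPath_treePath hT v o, fun hs => hw.1 ?_⟩
  exact hT.isAcyclic.eq_snd_of_adj_start (isPath_treePath hT v o) hw.2 hs

theorem parent_of_mem_children {o v w : V} (hw : w ∈ children T (parent hT o v) v) :
    parent hT o w = v := by
  obtain ⟨h, e⟩ := treePath_of_mem_children hT hw
  rw [parent, e, SimpleGraph.Walk.snd_cons]

theorem mem_children_parent {o v : V} (hv : v ≠ o) :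
    v ∈ children T (parent hT o (parent hT o v)) (parent hT o v) := by
  rw [mem_children]
  refine ⟨fun h => ?_, (adj_parent hT hv).symm⟩
  obtain ⟨h1, e1⟩ := treePath_of_ne hT hv
  have hp := isPath_treePath hT v o
  rw [e1, SimpleGraph.Walk.cons_isPath_iff] at hp
  refine hp.2 ?_
  have : (treePath hT (parent hT o v) o).snd ∈ (treePath hT (parent hT o v) o).support :=
    SimpleGraph.Walk.getVert_mem_support _ _
  change parent hT o (parent hT o v) ∈ _ at this
  rwa [← h] at this

theorem greenColumn_of_mem_children (t : ℝ) (Γ : V → V → ℂ) {o v w : V}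
    (hw : w ∈ children T (parent hT o v) v) :
    greenColumn hT t Γ o w = t * Γ v w * greenColumn hT t Γ o v := by
  obtain ⟨h, e⟩ := treePath_of_mem_children hT hw
  rw [greenColumn, e]
  rfl

theorem sum_neighborFinset {o v : V} (hv : v ≠ o) (f : V → ℂ) :
    ∑ w ∈ T.neighborFinset v, f w
      = f (parent hT o v) + ∑ w ∈ children T (parent hT o v) v, f w := by
  classical
  rw [children, Finset.add_sum_erase]
  exact (T.mem_neighborFinset _ _).2 (adj_parent hT hv)

theorem sum_neighborFinset_root (o : V) (f : V → ℂ) :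
    ∑ w ∈ T.neighborFinset o, f w = ∑ w ∈ children T (parent hT o o) o, f w := by
  classical
  rw [children, parent_root, Finset.erase_eq_of_notMem (by simp)]

variable {d : ℕ} (hG : ∀ v, T.degree v ≤ d) {t : ℝ} {z : ℂ} (hz : 0 < z.im) {q : V → ℝ}

include hG hz in
/-- The column solves `(H - z) ψ = δ_o` pointwise: at `v`, the equation is the recursion for the
branch at `v`, multiplied by the value at the parent of `v`. -/
theorem greenColumn_eq [DecidableEq V] (o v : V) :
    -(t : ℂ) * ∑ w ∈ T.neighborFinset v, greenColumn hT t (branchGreen T t z q) o w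
        + (q v : ℂ) * greenColumn hT t (branchGreen T t z q) o v
        - z * greenColumn hT t (branchGreen T t z q) o v = if v = o then 1 else 0 := by
  set Γ := branchGreen T t z q with hΓ
  set ψ := greenColumn hT t Γ o with hψ
  set S := z + (t : ℂ) ^ 2 * ∑ w ∈ children T (parent hT o v) v, Γ v w with hS
  have hS0 : (q v : ℂ) - S ≠ 0 := ofReal_sub_ne_zero _ (hz.trans_le
    (im_le_im_self_energy t z fun w _ => (admissible_branchGreen hG t hz q v w).1))
  have h1 : Γ (parent hT o v) v * ((q v : ℂ) - S) = 1 := by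
    rw [hΓ, branchGreen_eq hG t hz q, ← hΓ, ← hS, inv_mul_cancel₀ hS0]
  have h2 : ∑ w ∈ children T (parent hT o v) v, ψ w
      = t * (∑ w ∈ children T (parent hT o v) v, Γ v w) * ψ v := by
    rw [Finset.mul_sum, Finset.sum_mul]
    exact Finset.sum_congr rfl fun w hw => greenColumn_of_mem_children hT t Γ hw
  split_ifs with hv
  · subst hv
    rw [sum_neighborFinset_root hT, h2]
    have h3 : ψ v = Γ (parent hT v v) v := by
      rw [hψ, greenColumn_root, parent_root]
    rw [h3]
    rw [hS] at h1
    linear_combination h1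
  · rw [sum_neighborFinset hT hv, h2]
    have h3 : ψ v = t * Γ (parent hT o v) v * ψ (parent hT o v) :=
      greenColumn_of_mem_children hT t Γ (mem_children_parent hT hv)
    rw [hS] at h1
    rw [h3]
    linear_combination (t * ψ (parent hT o v)) * h1

include hG hz in
/-- Conservation of current: the part of the `ℓ²` norm of the column carried by the vertices below
`v` is `|ψ v|² Im S_v / Im z`, where `S_v` is the self-energy at `v`. -/
theorem sum_norm_greenColumn_sq_le (o : V) (s : Finset V) :
    z.im * ∑ v ∈ s, ‖greenColumn hT t (branchGreen T t z q) o v‖ ^ 2 ≤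
      (branchGreen T t z q o o).im := by
  classical
  set Γ := branchGreen T t z q with hΓ
  set ψ := greenColumn hT t Γ o with hψ
  let S : V → ℂ := fun v => z + (t : ℂ) ^ 2 * ∑ w ∈ children T (parent hT o v) v, Γ v w
  let F : V → ℝ := fun v => ‖ψ v‖ ^ 2 * (S v).im
  have hSim : ∀ v, z.im ≤ (S v).im := fun v =>
    im_le_im_self_energy t z fun w _ => (admissible_branchGreen hG t hz q v w).1
  have hF0 : ∀ v, 0 ≤ F v := fun v => mul_nonneg (sq_nonneg _) (hz.le.trans (hSim v))
  have hΓS : ∀ v, Γ (parent hT o v) v = ((q v : ℂ) - S v)⁻¹ := fun v =>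
    branchGreen_eq hG t hz q _ _
  have hF : ∀ v, F v = z.im * ‖ψ v‖ ^ 2 + ∑ w ∈ children T (parent hT o v) v, F w := by
    intro v
    have h1 : ∀ w ∈ children T (parent hT o v) v, F w = ‖ψ v‖ ^ 2 * (t ^ 2 * (Γ v w).im) := by
      intro w hw
      have h2 : ψ w = t * Γ v w * ψ v := greenColumn_of_mem_children hT t Γ hw
      have h3 := hΓS w
      rw [parent_of_mem_children hT hw] at h3
      have h4 : (Γ v w).im = (S w).im * ‖Γ v w‖ ^ 2 := by
        rw [h3]
        exact im_ofReal_sub_inv _ _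
      change ‖ψ w‖ ^ 2 * (S w).im = _
      rw [h2, h4, norm_mul, norm_mul, Complex.norm_real, Real.norm_eq_abs, mul_pow, mul_pow,
        sq_abs]
      ring
    rw [Finset.sum_congr rfl h1, ← Finset.mul_sum, ← Finset.mul_sum]
    change ‖ψ v‖ ^ 2 * (z + (t : ℂ) ^ 2 * ∑ w ∈ children T (parent hT o v) v, Γ v w).im = _
    rw [im_self_energy]
    ring
  let s' : Finset V := insert o (s.biUnion fun v => (treePath hT v o).support.toFinset)
  have hss' : s ⊆ s' := fun v hv => Finset.mem_insert_of_mem (Finset.mem_biUnion.2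
    ⟨v, hv, by simp⟩)
  have hpar : ∀ v ∈ s', parent hT o v ∈ s' := by
    intro v hv
    rcases Finset.mem_insert.1 hv with rfl | hv
    · rw [parent_root]
      exact hv
    · obtain ⟨x, hx, hv⟩ := Finset.mem_biUnion.1 hv
      refine Finset.mem_insert_of_mem (Finset.mem_biUnion.2 ⟨x, hx, ?_⟩)
      rw [List.mem_toFinset] at hv ⊢
      exact parent_mem_support hT hv
  have ho : o ∈ s' := Finset.mem_insert_self _ _
  have hsum : ∑ w ∈ s'.erase o, F w
      ≤ ∑ v ∈ s', ∑ w ∈ children T (parent hT o v) v, F w := by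
    rw [← Finset.sum_fiberwise_of_maps_to (s := s'.erase o) (t := s') (g := parent hT o)
      fun w hw => hpar w (Finset.mem_of_mem_erase hw)]
    refine Finset.sum_le_sum fun v _ => Finset.sum_le_sum_of_subset_of_nonneg ?_
      fun w _ _ => hF0 w
    intro w hw
    rw [Finset.mem_filter] at hw
    have := mem_children_parent hT (Finset.ne_of_mem_erase hw.1)
    rwa [hw.2] at this
  have htot : ∑ v ∈ s', F v = z.im * ∑ v ∈ s', ‖ψ v‖ ^ 2
      + ∑ v ∈ s', ∑ w ∈ children T (parent hT o v) v, F w := by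
    rw [Finset.mul_sum, ← Finset.sum_add_distrib]
    exact Finset.sum_congr rfl fun v _ => hF v
  have hroot : F o = (Γ o o).im := by
    change ‖ψ o‖ ^ 2 * (S o).im = _
    have h3 := hΓS o
    rw [parent_root] at h3
    have h4 : ψ o = Γ o o := greenColumn_root hT t Γ o
    rw [h4, h3, im_ofReal_sub_inv, mul_comm]
  rw [← Finset.add_sum_erase _ _ ho, hroot] at htot
  have hle : z.im * ∑ v ∈ s, ‖ψ v‖ ^ 2 ≤ z.im * ∑ v ∈ s', ‖ψ v‖ ^ 2 := by
    gcongr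
  linarith

include hT hG hz in
/-- The diagonal entry of the resolvent of the Anderson Hamiltonian on a tree satisfies the
recursion for the branches. -/
theorem resolventEntry_eq_branchGreen (o : V) :
    resolventEntry T hG t q o z = branchGreen T t z q o o := by
  classical
  set ψ₀ := greenColumn hT t (branchGreen T t z q) o with hψ₀
  have hmem : Memℓp ψ₀ 2 := by
    refine memℓp_gen' (C := (branchGreen T t z q o o).im / z.im) fun s => ?_
    rw [le_div_iff₀' hz]
    simpa using sum_norm_greenColumn_sq_le hT hG hz (t := t) (q := q) o s
  let ψ : Ell2 V := ⟨ψ₀, hmem⟩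
  let δ : Ell2 V := lp.single 2 o 1
  have hδ : ∀ v, δ v = if v = o then 1 else 0 := by
    intro v
    simp [δ, Pi.single_apply]
  have hA : ∀ v, adjacencyOp T hG ψ v = ∑ w ∈ T.neighborFinset v, ψ₀ w := fun _ => rfl
  have hq : (fun v => (q v : ℂ) * ψ v)
      = ((δ + z • ψ + (t : ℂ) • adjacencyOp T hG ψ : Ell2 V) : V → ℂ) := by
    funext v
    change (q v : ℂ) * ψ₀ v = δ v + z * ψ₀ v + t * adjacencyOp T hG ψ v
    rw [hA, hδ, ← greenColumn_eq hT hG hz (t := t) (q := q) o v]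
    ring
  have hdom : ψ ∈ (hamiltonian T hG t q).domain := by
    change Memℓp (fun v => (q v : ℂ) * ψ v) 2
    rw [hq]
    exact lp.memℓp _
  have heq : hamiltonian T hG t q ⟨ψ, hdom⟩ - z • ψ = δ := by
    ext v
    change (-(t : ℂ)) * adjacencyOp T hG ψ v + (q v : ℂ) * ψ₀ v - z * ψ₀ v = δ v
    rw [hA, hδ]
    exact greenColumn_eq hT hG hz o v
  have hR := (isResolventAt_hamiltonian T hG t q hz).left_inv ⟨ψ, hdom⟩
  rw [heq] at hR
  have : resolventEntry T hG t q o z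
      = ⟪δ, resolventOp (hamiltonian T hG t q) z δ⟫_ℂ := by
    unfold resolventEntry
    congr!
  rw [this, hR, lp.inner_single_left]
  have h4 : ψ₀ o = branchGreen T t z q o o := greenColumn_root hT t _ o
  change ⟪(1 : ℂ), ψ₀ o⟫_ℂ = _
  rw [h4]
  simp

end RootedTree

/-! ### Independence and equality in law of the branches -/

section Branches

variable {V : Type*} {T : SimpleGraph V} (hT : T.IsTree)

/-- The branch at `v` that avoids `u`: the vertices whose path to `v` does not meet `u`. -/
def branch (u v : V) : Set V := {x | u ∉ (treePath hT v x).support}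

theorem treePath_of_mem_branch {v w x : V} (h : T.Adj v w) (hx : x ∈ branch hT v w) :
    treePath hT v x = .cons h (treePath hT w x) :=
  (eq_treePath hT ((SimpleGraph.Walk.cons_isPath_iff _ _).2 ⟨isPath_treePath hT w x, hx⟩)).symm

theorem self_mem_branch {u v : V} (h : T.Adj u v) : v ∈ branch hT u v := by
  change u ∉ (treePath hT v v).support
  rw [treePath_self]
  simpa using h.ne

theorem notMem_branch (v w : V) : v ∉ branch hT v w := fun h =>
  h (SimpleGraph.Walk.end_mem_support _)

theorem branch_subset {u v w : V} (huv : T.Adj u v) (hvw : T.Adj v w) (hw : w ≠ u) :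
    branch hT v w ⊆ branch hT u v := by
  intro x hx hu
  have h := hT.isAcyclic.eq_snd_of_adj_start (isPath_treePath hT v x) huv.symm hu
  rw [treePath_of_mem_branch hT hvw hx, SimpleGraph.Walk.snd_cons] at h
  exact hw h.symm

theorem disjoint_branch {v w w' : V} (hw : T.Adj v w) (hw' : T.Adj v w') (hne : w ≠ w') :
    Disjoint (branch hT v w) (branch hT v w') := by
  rw [Set.disjoint_left]
  intro x hx hx'
  have h := congrArg SimpleGraph.Walk.snd (treePath_of_mem_branch hT hw hx)
  rw [treePath_of_mem_branch hT hw' hx', SimpleGraph.Walk.snd_cons,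
    SimpleGraph.Walk.snd_cons] at h
  exact hne h.symm

end Branches

section Sigma

variable {V Ω : Type*}

/-- The σ-algebra generated by the potential at the sites of `S`. -/
abbrev siteSigma (g : V → Ω → ℝ) (S : Set V) : MeasurableSpace Ω :=
  ⨆ x ∈ S, MeasurableSpace.comap (g x) inferInstance

theorem siteSigma_mono (g : V → Ω → ℝ) {S S' : Set V} (h : S ⊆ S') :
    siteSigma g S ≤ siteSigma g S' :=
  biSup_mono h

theorem measurable_siteSigma (g : V → Ω → ℝ) {S : Set V} {x : V} (hx : x ∈ S) :
    Measurable[siteSigma g S] (g x) :=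
  (comap_measurable (g x)).mono
    (le_iSup₂_of_le (f := fun x (_ : x ∈ S) => MeasurableSpace.comap (g x) inferInstance)
      x hx le_rfl) le_rfl

variable [mΩ : MeasurableSpace Ω]

theorem siteSigma_le {g : V → Ω → ℝ} (hg : ∀ v, Measurable (g v)) (S : Set V) :
    siteSigma g S ≤ mΩ :=
  iSup₂_le fun x _ => (hg x).comap_le

theorem indepFun_of_disjoint {P : Measure Ω} {g : V → Ω → ℝ} (hg : ∀ v, Measurable (g v))
    (hind : iIndepFun g P) {S S' : Set V} (hS : Disjoint S S') {α β : Type*}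
    [mα : MeasurableSpace α] [mβ : MeasurableSpace β] {X : Ω → α} {Y : Ω → β}
    (hX : Measurable[siteSigma g S] X) (hY : Measurable[siteSigma g S'] Y) : IndepFun X Y P := by
  have h : Indep (siteSigma g S) (siteSigma g S') P :=
    indep_iSup_of_disjoint (fun x => (hg x).comap_le) hind hS
  rw [IndepFun_iff_Indep]
  exact indep_of_indep_of_le_left (indep_of_indep_of_le_right h hY.comap_le) hX.comap_le

end Sigma

section Law

variable {Ω : Type*} [MeasurableSpace Ω] {P : Measure Ω} [IsProbabilityMeasure P]

theorem identDistrib_prodMk {α β : Type*} [MeasurableSpace α] [MeasurableSpace β]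
    {X X' : Ω → α} {Y Y' : Ω → β} (hX : IdentDistrib X X' P P) (hY : IdentDistrib Y Y' P P)
    (h : IndepFun X Y P) (h' : IndepFun X' Y' P) :
    IdentDistrib (fun ω => (X ω, Y ω)) (fun ω => (X' ω, Y' ω)) P P where
  aemeasurable_fst := hX.aemeasurable_fst.prodMk hY.aemeasurable_fst
  aemeasurable_snd := hX.aemeasurable_snd.prodMk hY.aemeasurable_snd
  map_eq := by
    rw [(indepFun_iff_map_prod_eq_prod_map_map hX.aemeasurable_fst hY.aemeasurable_fst).1 h,
      (indepFun_iff_map_prod_eq_prod_map_map hX.aemeasurable_snd hY.aemeasurable_snd).1 h',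
      hX.map_eq, hY.map_eq]

/-- Equality in law passes to pointwise limits. -/
theorem identDistrib_of_tendsto {X Y : ℕ → Ω → ℂ} {X' Y' : Ω → ℂ}
    (hXm : ∀ n, Measurable (X n)) (hYm : ∀ n, Measurable (Y n))
    (h : ∀ n, IdentDistrib (X n) (Y n) P P)
    (hX : ∀ ω, Filter.Tendsto (fun n => X n ω) Filter.atTop (𝓝 (X' ω)))
    (hY : ∀ ω, Filter.Tendsto (fun n => Y n ω) Filter.atTop (𝓝 (Y' ω))) :
    IdentDistrib X' Y' P P := by
  have hXm' : Measurable X' := measurable_of_tendsto_metrizable hXm (tendsto_pi_nhds.2 hX)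
  have hYm' : Measurable Y' := measurable_of_tendsto_metrizable hYm (tendsto_pi_nhds.2 hY)
  refine ⟨hXm'.aemeasurable, hYm'.aemeasurable, ?_⟩
  have hi : ∀ X : Ω → ℂ, Measurable X → IsProbabilityMeasure (P.map X) := fun X hX =>
    Measure.isProbabilityMeasure_map hX.aemeasurable
  have := hi X' hXm'
  have := hi Y' hYm'
  refine ext_of_forall_integral_eq_of_IsFiniteMeasure fun f => ?_
  have key : ∀ (Z : ℕ → Ω → ℂ) (Z' : Ω → ℂ), (∀ n, Measurable (Z n)) → Measurable Z' →
      (∀ ω, Filter.Tendsto (fun n => Z n ω) Filter.atTop (𝓝 (Z' ω))) →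
      Filter.Tendsto (fun n => ∫ ω, f (Z n ω) ∂P) Filter.atTop (𝓝 (∫ x, f x ∂(P.map Z'))) := by
    intro Z Z' hZ hZ' hlim
    rw [integral_map hZ'.aemeasurable f.continuous.aestronglyMeasurable]
    refine tendsto_integral_of_dominated_convergence (fun _ => ‖f‖) (fun n => ?_)
      (integrable_const _) (fun n => ?_) ?_
    · exact (f.continuous.measurable.comp (hZ n)).aestronglyMeasurable
    · exact Filter.Eventually.of_forall fun ω => f.norm_coe_le_norm _
    · exact Filter.Eventually.of_forall fun ω => (f.continuous.tendsto _).comp (hlim ω)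
  refine tendsto_nhds_unique (key X X' hXm hXm' hX) ?_
  refine (key Y Y' hYm hYm' hY).congr fun n => ?_
  exact ((h n).comp f.continuous.measurable).integral_eq.symm

end Law

section TreeLaw

variable {V : Type*} {T : SimpleGraph V} [T.LocallyFinite] (hT : T.IsTree)
  {Ω : Type*} [MeasurableSpace Ω] {P : Measure Ω} [IsProbabilityMeasure P]
  {g : V → Ω → ℝ}

theorem measurable_ofReal_sub_inv {Ω : Type*} [MeasurableSpace Ω] {f : Ω → ℝ} (hf : Measurable f)
    {s : Finset V} {F : V → Ω → ℂ} (hF : ∀ w ∈ s, Measurable (F w)) (t : ℝ) (z : ℂ) :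
    Measurable fun ω => ((f ω : ℂ) - (z + (t : ℂ) ^ 2 * ∑ w ∈ s, F w ω))⁻¹ := by
  have h : Measurable fun ω => ∑ w ∈ s, F w ω := Finset.measurable_fun_sum s hF
  fun_prop

omit [MeasurableSpace Ω] in
theorem measurable_branchStep_iterate (t : ℝ) (z : ℂ) (n : ℕ) {u v : V} (huv : T.Adj u v) :
    Measurable[siteSigma g (branch hT u v)]
      fun ω => (branchStep T t z fun x => g x ω)^[n] 0 u v := by
  induction n generalizing u v with
  | zero => exact measurable_const
  | succ n ih =>
    simp only [Function.iterate_succ_apply']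
    refine @measurable_ofReal_sub_inv V Ω (siteSigma g (branch hT u v)) (g v)
      (measurable_siteSigma g (self_mem_branch hT huv)) _ _ (fun w hw => ?_) t z
    rw [mem_children] at hw
    exact (ih hw.2).mono (siteSigma_mono g (branch_subset hT huv hw.2 hw.1)) le_rfl

omit [MeasurableSpace Ω] in
theorem measurable_branchGreen {d : ℕ} (hG : ∀ v, T.degree v ≤ d) (t : ℝ) {z : ℂ}
    (hz : 0 < z.im) {u v : V} (huv : T.Adj u v) :
    Measurable[siteSigma g (branch hT u v)] fun ω => branchGreen T t z (fun x => g x ω) u v :=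
  @measurable_of_tendsto_metrizable Ω ℂ (siteSigma g (branch hT u v)) _ _ _ _ _ _
    (fun n => measurable_branchStep_iterate hT t z n huv)
    (tendsto_pi_nhds.2 fun ω => tendsto_branchGreen hG t hz (fun x => g x ω) u v)

omit [T.LocallyFinite] in
/-- Sums over equally many children have the same law, if the summands of any two branches do. -/
theorem identDistrib_sum_children (hg : ∀ v, Measurable (g v)) (hind : iIndepFun g P)
    {F : V → V → Ω → ℂ}
    (hF : ∀ u v, T.Adj u v → Measurable[siteSigma g (branch hT u v)] (F u v))
    (hlaw : ∀ u v u' v', T.Adj u v → T.Adj u' v' → IdentDistrib (F u v) (F u' v') P P)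
    (v v' : V) (s s' : Finset V) (hs : ∀ w ∈ s, T.Adj v w) (hs' : ∀ w ∈ s', T.Adj v' w)
    (hcard : s.card = s'.card) :
    IdentDistrib (fun ω => ∑ w ∈ s, F v w ω) (fun ω => ∑ w ∈ s', F v' w ω) P P := by
  classical
  have hsum : ∀ (v : V) (s : Finset V), (∀ w ∈ s, T.Adj v w) →
      Measurable[siteSigma g (⋃ w ∈ s, branch hT v w)] fun ω => ∑ w ∈ s, F v w ω := by
    intro v s hs
    refine @Finset.measurable_fun_sum _ _ _ _ _ _ (siteSigma g (⋃ w ∈ s, branch hT v w)) _ s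
      fun w hw => ?_
    exact (hF v w (hs w hw)).mono (siteSigma_mono g
      (Set.subset_biUnion_of_mem (u := fun w => branch hT v w) hw)) le_rfl
  have hindep : ∀ (v a : V) (s : Finset V), a ∉ s → (∀ w ∈ insert a s, T.Adj v w) →
      IndepFun (F v a) (fun ω => ∑ w ∈ s, F v w ω) P := by
    intro v a s ha hs
    refine indepFun_of_disjoint hg hind ?_ (hF v a (hs a (Finset.mem_insert_self _ _)))
      (hsum v s fun w hw => hs w (Finset.mem_insert_of_mem hw))
    rw [Set.disjoint_iUnion₂_right]
    intro w hw
    exact disjoint_branch hT (hs a (Finset.mem_insert_self _ _))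
      (hs w (Finset.mem_insert_of_mem hw)) fun h => ha (h ▸ hw)
  induction s using Finset.induction_on generalizing s' with
  | empty =>
    rw [Finset.card_empty, eq_comm, Finset.card_eq_zero] at hcard
    subst hcard
    exact IdentDistrib.refl aemeasurable_const
  | insert a s ha ih =>
    rw [Finset.card_insert_of_notMem ha, eq_comm, Finset.card_eq_succ] at hcard
    obtain ⟨a', s'', ha', rfl, hcard⟩ := hcard
    simp only [Finset.sum_insert ha, Finset.sum_insert ha']
    have h1 := ih s'' (fun w hw => hs w (Finset.mem_insert_of_mem hw))
      (fun w hw => hs' w (Finset.mem_insert_of_mem hw)) hcard.symm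
    have h2 := hlaw v a v' a' (hs a (Finset.mem_insert_self _ _))
      (hs' a' (Finset.mem_insert_self _ _))
    exact (identDistrib_prodMk h2 h1 (hindep v a s ha hs) (hindep v' a' s'' ha' hs')).comp
      (u := fun p : ℂ × ℂ => p.1 + p.2) (by fun_prop)

theorem card_children {d : ℕ} (hreg : T.IsRegularOfDegree d) {u v : V} (h : T.Adj u v) :
    (children T u v).card = d - 1 := by
  classical
  rw [children, Finset.card_erase_of_mem (by simpa using h.symm), T.card_neighborFinset_eq_degree,
    hreg v]

include hT in
theorem identDistrib_branchStep_iterate {d : ℕ} (hreg : T.IsRegularOfDegree d)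
    (hg : ∀ v, Measurable (g v)) (hind : iIndepFun g P)
    (hglaw : ∀ v, P.map (g v) = gaussianReal 0 1) (t : ℝ) (z : ℂ) (n : ℕ) {u v u' v' : V}
    (h : T.Adj u v) (h' : T.Adj u' v') :
    IdentDistrib (fun ω => (branchStep T t z fun x => g x ω)^[n] 0 u v)
      (fun ω => (branchStep T t z fun x => g x ω)^[n] 0 u' v') P P := by
  induction n generalizing u v u' v' with
  | zero => exact IdentDistrib.refl aemeasurable_const
  | succ n ih =>
    simp only [Function.iterate_succ_apply']
    let F : V → V → Ω → ℂ := fun u v ω => (branchStep T t z fun x => g x ω)^[n] 0 u v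
    have hF : ∀ u v, T.Adj u v → Measurable[siteSigma g (branch hT u v)] (F u v) :=
      fun u v huv => measurable_branchStep_iterate hT t z n huv
    have hch : ∀ u v w, w ∈ children T u v → T.Adj v w := fun u v w hw =>
      ((mem_children T).1 hw).2
    have hsum := identDistrib_sum_children hT hg hind hF (fun u v u' v' h h' => ih h h') v v'
      (children T u v) (children T u' v') (hch u v) (hch u' v')
      (by rw [card_children hreg h, card_children hreg h'])
    have hindep : ∀ u v, IndepFun (g v) (fun ω => ∑ w ∈ children T u v, F v w ω) P := by
      intro u v
      refine indepFun_of_disjoint hg hind (S := {v}) (S' := ⋃ w ∈ children T u v, branch hT v w)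
        ?_ (measurable_siteSigma g rfl) ?_
      · rw [Set.disjoint_singleton_left]
        simp only [Set.mem_iUnion, not_exists]
        exact fun w _ => notMem_branch hT v w
      · refine @Finset.measurable_fun_sum _ _ _ _ _ _ (siteSigma g _) _ _ fun w hw => ?_
        exact (hF v w (hch u v w hw)).mono (siteSigma_mono g
          (Set.subset_biUnion_of_mem (u := fun w => branch hT v w) hw)) le_rfl
    have hgg : IdentDistrib (g v) (g v') P P :=
      ⟨(hg v).aemeasurable, (hg v').aemeasurable, by rw [hglaw, hglaw]⟩
    exact (identDistrib_prodMk hgg hsum (hindep u v) (hindep u' v')).comp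
      (u := fun p : ℝ × ℂ => ((p.1 : ℂ) - (z + (t : ℂ) ^ 2 * p.2))⁻¹) (by fun_prop)

include hT in
/-- In a regular tree, the Green functions of all branches have the same law. -/
theorem identDistrib_branchGreen {d : ℕ} (hreg : T.IsRegularOfDegree d)
    (hg : ∀ v, Measurable (g v)) (hind : iIndepFun g P)
    (hglaw : ∀ v, P.map (g v) = gaussianReal 0 1) (t : ℝ) {z : ℂ} (hz : 0 < z.im)
    {u v u' v' : V} (h : T.Adj u v) (h' : T.Adj u' v') :
    IdentDistrib (fun ω => branchGreen T t z (fun x => g x ω) u v)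
      (fun ω => branchGreen T t z (fun x => g x ω) u' v') P P := by
  have hm : ∀ n u v, T.Adj u v →
      Measurable fun ω => (branchStep T t z fun x => g x ω)^[n] 0 u v := fun n u v h =>
    (measurable_branchStep_iterate hT t z n h).mono (siteSigma_le hg _) le_rfl
  exact identDistrib_of_tendsto (fun n => hm n u v h) (fun n => hm n u' v' h')
    (fun n => identDistrib_branchStep_iterate hT hreg hg hind hglaw t z n h h')
    (fun ω => tendsto_branchGreen (fun v => (hreg v).le) t hz (fun x => g x ω) u v)
    (fun ω => tendsto_branchGreen (fun v => (hreg v).le) t hz (fun x => g x ω) u' v')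

end TreeLaw

/-! ### Averaging over one Gaussian variable -/

section Gaussian

theorem gaussianReal_le_volume : gaussianReal 0 1 ≤ (volume : Measure ℝ) := by
  rw [gaussianReal_of_var_ne_zero _ one_ne_zero]
  conv_rhs => rw [← withDensity_one (μ := (volume : Measure ℝ))]
  refine withDensity_mono (Filter.Eventually.of_forall fun x => ?_)
  rw [gaussianPDF, Pi.one_apply, ← ENNReal.ofReal_one]
  refine ENNReal.ofReal_le_ofReal ?_
  rw [gaussianPDFReal]
  have h1 : (√(2 * Real.pi * ((1 : NNReal) : ℝ)))⁻¹ ≤ 1 := by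
    refine inv_le_one_of_one_le₀ (Real.one_le_sqrt.2 ?_)
    have := Real.pi_gt_three
    simp
    linarith
  have h2 : Real.exp (-(x - 0) ^ 2 / (2 * ((1 : NNReal) : ℝ))) ≤ 1 := by
    rw [Real.exp_le_one_iff]
    exact div_nonpos_of_nonpos_of_nonneg (neg_nonpos.2 (sq_nonneg _)) (by positivity)
  exact mul_le_one₀ h1 (Real.exp_pos _).le h2

variable {Ω : Type*} [MeasurableSpace Ω] {P : Measure Ω} [IsProbabilityMeasure P]

/-- The law of a standard Gaussian variable is bounded by Lebesgue measure, also conditionally on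
an independent variable. -/
theorem lintegral_gaussian_le {A : Ω → ℝ} {S : Ω → ℂ} (hA : Measurable A)
    (hlaw : P.map A = gaussianReal 0 1) (hS : Measurable S) (h : IndepFun A S P)
    {F : ℝ × ℂ → ℝ≥0∞} (hF : Measurable F) {B : ℂ → ℝ≥0∞}
    (hFB : ∀ ω, ∫⁻ x, F (x, S ω) ≤ B (S ω)) :
    ∫⁻ ω, F (A ω, S ω) ∂P ≤ ∫⁻ ω, B (S ω) ∂P := by
  have : IsProbabilityMeasure (P.map S) := Measure.isProbabilityMeasure_map hS.aemeasurable
  have hinner : Measurable fun s => ∫⁻ x, F (x, s) ∂(gaussianReal 0 1) :=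
    Measurable.lintegral_prod_left' hF
  calc ∫⁻ ω, F (A ω, S ω) ∂P = ∫⁻ p, F p ∂(P.map fun ω => (A ω, S ω)) :=
        (lintegral_map hF (hA.prodMk hS)).symm
    _ = ∫⁻ s, ∫⁻ x, F (x, s) ∂(gaussianReal 0 1) ∂(P.map S) := by
        rw [(indepFun_iff_map_prod_eq_prod_map_map hA.aemeasurable hS.aemeasurable).1 h, hlaw,
          lintegral_prod_symm' _ hF]
    _ = ∫⁻ ω, ∫⁻ x, F (x, S ω) ∂(gaussianReal 0 1) ∂P := lintegral_map hinner hS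
    _ ≤ ∫⁻ ω, B (S ω) ∂P := lintegral_mono fun ω =>
        (lintegral_mono' gaussianReal_le_volume le_rfl).trans (hFB ω)

theorem norm_ofReal_sub_sq (x : ℝ) (s : ℂ) :
    ‖(x : ℂ) - s‖ ^ 2 = (x - s.re) ^ 2 + s.im ^ 2 := by
  rw [← Complex.normSq_eq_norm_sq, Complex.normSq_apply]
  simp
  ring

theorem abs_sub_re_le (x : ℝ) (s : ℂ) : |x - s.re| ≤ ‖(x : ℂ) - s‖ := by
  have := Complex.abs_re_le_norm ((x : ℂ) - s)
  simpa using this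

/-- The singularity `|x| ^ (-1/2)` near the origin. -/
noncomputable def rootSing (x : ℝ) : ℝ≥0∞ :=
  ENNReal.ofReal (Set.indicator (Set.Icc (-1) 1) (fun x => √(|x|⁻¹)) x)

theorem lintegral_rootSing_lt_top : ∫⁻ x, rootSing x < ∞ := by
  have h1 : IntegrableOn (fun x : ℝ => x ^ (-(1 / 2) : ℝ)) (Set.Ioc 0 1) := by
    have := intervalIntegral.intervalIntegrable_rpow' (a := 0) (b := 1) (r := (-(1 / 2) : ℝ))
      (by norm_num)
    rwa [intervalIntegrable_iff_integrableOn_Ioc_of_le zero_le_one] at this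
  let h : ℝ → ℝ := Set.indicator (Set.Ioc 0 1) fun x : ℝ => x ^ (-(1 / 2) : ℝ)
  have h2 : Integrable h := h1.integrable_indicator measurableSet_Ioc
  have h3 : Integrable fun x => h x + h (-x) := h2.add h2.comp_neg
  have hh : ∀ x, 0 ≤ h x := fun x => Set.indicator_nonneg (fun y hy =>
    Real.rpow_nonneg hy.1.le _) x
  have hr : ∀ x : ℝ, 0 < x → √(x⁻¹) = x ^ (-(1 / 2) : ℝ) := by
    intro x hx
    rw [Real.sqrt_eq_rpow, Real.inv_rpow hx.le, Real.rpow_neg hx.le]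
  have hle : ∀ x, rootSing x ≤ ENNReal.ofReal (h x + h (-x)) := by
    intro x
    refine ENNReal.ofReal_le_ofReal ?_
    by_cases hx : x ∈ Set.Icc (-1 : ℝ) 1
    · rw [Set.indicator_of_mem hx]
      rcases lt_trichotomy x 0 with h0 | h0 | h0
      · have : h (-x) = √(|x|⁻¹) := by
          rw [abs_of_neg h0, hr _ (by linarith)]
          have hm : -x ∈ Set.Ioc (0 : ℝ) 1 := ⟨by linarith, by linarith [hx.1]⟩
          exact Set.indicator_of_mem hm _
        linarith [hh x]
      · subst h0
        simpa using add_nonneg (hh 0) (hh 0)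
      · have : h x = √(|x|⁻¹) := by
          rw [abs_of_pos h0, hr _ h0]
          have hm : x ∈ Set.Ioc (0 : ℝ) 1 := ⟨h0, hx.2⟩
          exact Set.indicator_of_mem hm _
        linarith [hh (-x)]
    · rw [Set.indicator_of_notMem hx]
      exact add_nonneg (hh _) (hh _)
  exact (lintegral_mono hle).trans_lt h3.lintegral_lt_top

/-- A bound on the half moment of the Green function that is uniform in the self-energy. -/
noncomputable def halfMoment : ℝ≥0∞ := 1 + ∫⁻ x, rootSing x

theorem halfMoment_lt_top : halfMoment < ∞ :=
  ENNReal.add_lt_top.2 ⟨ENNReal.one_lt_top, lintegral_rootSing_lt_top⟩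

theorem lintegral_sqrt_norm_inv_le {A : Ω → ℝ} {S : Ω → ℂ} (hA : Measurable A)
    (hlaw : P.map A = gaussianReal 0 1) (hS : Measurable S) (h : IndepFun A S P) :
    ∫⁻ ω, ENNReal.ofReal (√‖((A ω : ℂ) - S ω)⁻¹‖) ∂P ≤ halfMoment := by
  let F : ℝ × ℂ → ℝ≥0∞ := fun p => ENNReal.ofReal
    (Set.indicator (Set.Iic 1) (fun y => √(y⁻¹)) ‖(p.1 : ℂ) - p.2‖)
  have hF : Measurable F := by
    have h1 : Measurable (Set.indicator (Set.Iic 1) fun y : ℝ => √(y⁻¹)) :=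
      (measurable_inv.sqrt).indicator measurableSet_Iic
    have h2 : Measurable fun p : ℝ × ℂ => ‖(p.1 : ℂ) - p.2‖ := by fun_prop
    exact ENNReal.measurable_ofReal.comp (h1.comp h2)
  have hle : ∀ ω, ENNReal.ofReal (√‖((A ω : ℂ) - S ω)⁻¹‖) ≤ 1 + F (A ω, S ω) := by
    intro ω
    rw [norm_inv]
    by_cases h1 : ‖(A ω : ℂ) - S ω‖ ≤ 1
    · have : F (A ω, S ω) = ENNReal.ofReal (√(‖(A ω : ℂ) - S ω‖⁻¹)) := by
        change ENNReal.ofReal (Set.indicator (Set.Iic 1) _ _) = _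
        rw [Set.indicator_of_mem (Set.mem_Iic.2 h1)]
      rw [this]
      exact le_add_self
    · refine le_trans ?_ le_self_add
      rw [← ENNReal.ofReal_one]
      refine ENNReal.ofReal_le_ofReal ?_
      refine Real.sqrt_le_one.2 ?_
      exact inv_le_one_of_one_le₀ (not_le.1 h1).le
  have hFB : ∀ s : ℂ, ∫⁻ x, F (x, s) ≤ ∫⁻ x, rootSing x := by
    intro s
    rw [← lintegral_sub_right_eq_self rootSing s.re]
    refine lintegral_mono_ae ?_
    have hne : ∀ᵐ x : ℝ, x ≠ s.re := by simp [ae_iff]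
    filter_upwards [hne] with x hx
    refine ENNReal.ofReal_le_ofReal ?_
    have hab := abs_sub_re_le x s
    have hpos : 0 < |x - s.re| := abs_pos.2 (sub_ne_zero.2 hx)
    by_cases h1 : ‖(x : ℂ) - s‖ ≤ 1
    · have hm : x - s.re ∈ Set.Icc (-1 : ℝ) 1 := abs_le.1 (hab.trans h1)
      rw [Set.indicator_of_mem (Set.mem_Iic.2 h1), Set.indicator_of_mem hm]
      gcongr
    · rw [Set.indicator_of_notMem (by simpa using h1)]
      exact Set.indicator_nonneg (fun _ _ => Real.sqrt_nonneg _) _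
  calc _ ≤ ∫⁻ ω, (1 + F (A ω, S ω)) ∂P := lintegral_mono hle
    _ = 1 + ∫⁻ ω, F (A ω, S ω) ∂P := by
        rw [lintegral_add_left measurable_const, lintegral_one, measure_univ]
    _ ≤ 1 + ∫⁻ ω, (∫⁻ x, rootSing x) ∂P := by
        refine add_le_add le_rfl ?_
        exact lintegral_gaussian_le hA hlaw hS h hF
          (B := fun _ => ∫⁻ x, rootSing x) fun ω => hFB (S ω)
    _ = halfMoment := by rw [lintegral_const, measure_univ, mul_one, halfMoment]

/-- If `Im S` is small, then `Im (A - S)⁻¹` exceeds `c` only for `A` in a short interval around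
`Re S`. -/
theorem measure_im_inv_gt_le {A : Ω → ℝ} {S : Ω → ℂ} (hA : Measurable A)
    (hlaw : P.map A = gaussianReal 0 1) (hS : Measurable S) (h : IndepFun A S P)
    {c ε : ℝ} (hc : 0 < c) :
    P {ω | c < (((A ω : ℂ) - S ω)⁻¹).im ∧ (S ω).im ≤ ε} ≤ ENNReal.ofReal (2 * √(ε / c)) := by
  let D : Set (ℝ × ℂ) := {p | c < (((p.1 : ℂ) - p.2)⁻¹).im ∧ p.2.im ≤ ε}
  have hm1 : Measurable fun p : ℝ × ℂ => (((p.1 : ℂ) - p.2)⁻¹).im := by fun_prop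
  have hm2 : Measurable fun p : ℝ × ℂ => p.2.im := by fun_prop
  have hD : MeasurableSet D :=
    (measurableSet_lt measurable_const hm1).inter (measurableSet_le hm2 measurable_const)
  have hFB : ∀ s : ℂ, ∫⁻ x, D.indicator 1 (x, s) ≤ ENNReal.ofReal (2 * √(ε / c)) := by
    intro s
    have hsub : ∀ x : ℝ, (x, s) ∈ D → x ∈ Set.Icc (s.re - √(ε / c)) (s.re + √(ε / c)) := by
      rintro x ⟨h1, h2⟩
      change c < (((x : ℂ) - s)⁻¹).im at h1
      change s.im ≤ ε at h2
      rw [im_ofReal_sub_inv, norm_inv, inv_pow, norm_ofReal_sub_sq, ← div_eq_mul_inv] at h1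
      have hpos : 0 < (x - s.re) ^ 2 + s.im ^ 2 := by
        by_contra h0
        have h0' : (x - s.re) ^ 2 + s.im ^ 2 = 0 := le_antisymm (not_lt.1 h0) (by positivity)
        rw [h0', div_zero] at h1
        exact absurd h1 hc.not_gt
      rw [lt_div_iff₀ hpos] at h1
      have h3 : (x - s.re) ^ 2 ≤ ε / c := by
        rw [le_div_iff₀ hc]
        nlinarith [sq_nonneg s.im]
      have h4 := abs_le.1 (Real.abs_le_sqrt h3)
      exact ⟨by linarith [h4.1], by linarith [h4.2]⟩
    calc ∫⁻ x, D.indicator 1 (x, s)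
        ≤ ∫⁻ x, (Set.Icc (s.re - √(ε / c)) (s.re + √(ε / c))).indicator 1 x := by
          refine lintegral_mono fun x => ?_
          by_cases hx : (x, s) ∈ D
          · rw [Set.indicator_of_mem hx, Set.indicator_of_mem (hsub x hx)]
            rfl
          · rw [Set.indicator_of_notMem hx]
            exact zero_le
      _ = ENNReal.ofReal (2 * √(ε / c)) := by
          rw [lintegral_indicator_one measurableSet_Icc, Real.volume_Icc]
          congr 1
          ring
  have hset : MeasurableSet {ω | (A ω, S ω) ∈ D} := (hA.prodMk hS) hD
  calc P {ω | (A ω, S ω) ∈ D} = ∫⁻ ω, D.indicator 1 (A ω, S ω) ∂P := by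
        rw [← lintegral_indicator_one hset]
        rfl
    _ ≤ ∫⁻ ω, ENNReal.ofReal (2 * √(ε / c)) ∂P :=
        lintegral_gaussian_le hA hlaw hS h (measurable_one.indicator hD)
          (B := fun _ => ENNReal.ofReal (2 * √(ε / c))) fun ω => hFB (S ω)
    _ = _ := by rw [lintegral_const, measure_univ, mul_one]

theorem lintegral_inv_sq_add_sq (a : ℝ) {b : ℝ} (hb : 0 < b) :
    ∫⁻ x : ℝ, ENNReal.ofReal (((x - a) ^ 2 + b ^ 2)⁻¹) = ENNReal.ofReal (Real.pi / b) := by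
  rw [lintegral_sub_right_eq_self (fun x => ENNReal.ofReal ((x ^ 2 + b ^ 2)⁻¹)) a]
  have he : ∀ x : ℝ, (x ^ 2 + b ^ 2)⁻¹ = (b ^ 2)⁻¹ * (1 + (x / b) ^ 2)⁻¹ := by
    intro x
    rw [← mul_inv]
    congr 1
    field_simp
    ring
  have hi : Integrable fun x : ℝ => (x ^ 2 + b ^ 2)⁻¹ := by
    simp only [he]
    exact (integrable_inv_one_add_sq.comp_div hb.ne').const_mul _
  rw [← ofReal_integral_eq_lintegral_ofReal hi
    (Filter.Eventually.of_forall fun x => by positivity)]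
  congr 1
  simp only [he]
  rw [integral_const_mul, Measure.integral_comp_div (fun x : ℝ => (1 + x ^ 2)⁻¹) b,
    integral_univ_inv_one_add_sq, abs_of_pos hb, smul_eq_mul]
  field_simp

theorem lintegral_im_inv_sq_le {A : Ω → ℝ} {S : Ω → ℂ} (hA : Measurable A)
    (hlaw : P.map A = gaussianReal 0 1) (hS : Measurable S) (h : IndepFun A S P)
    (hpos : ∀ ω, 0 < (S ω).im) :
    ∫⁻ ω, ENNReal.ofReal ((((A ω : ℂ) - S ω)⁻¹).im ^ 2) ∂P
      ≤ ∫⁻ ω, ENNReal.ofReal (Real.pi / (S ω).im) ∂P := by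
  refine lintegral_gaussian_le hA hlaw hS h
    (F := fun p => ENNReal.ofReal ((((p.1 : ℂ) - p.2)⁻¹).im ^ 2)) (by fun_prop)
    (B := fun s => ENNReal.ofReal (Real.pi / s.im)) fun ω => ?_
  rw [← lintegral_inv_sq_add_sq (S ω).re (hpos ω)]
  refine lintegral_mono fun x => ENNReal.ofReal_le_ofReal ?_
  have hp : 0 < (x - (S ω).re) ^ 2 + (S ω).im ^ 2 := by
    have := hpos ω
    positivity
  simp only
  rw [im_ofReal_sub_inv, norm_inv, inv_pow, norm_ofReal_sub_sq, mul_pow, inv_pow, ← div_eq_mul_inv,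
    div_le_iff₀ (by positivity)]
  field_simp
  nlinarith [sq_nonneg (x - (S ω).re)]

end Gaussian

/-! ### Random branch Green functions -/

section RandomBranch

variable {V : Type*} {T : SimpleGraph V} [T.LocallyFinite]
  {Ω : Type*} {g : V → Ω → ℝ} {d : ℕ} {t : ℝ} {z : ℂ}

/-- The branch Green function for the random potential `g`. -/
noncomputable abbrev randGreen {V Ω : Type*} (T : SimpleGraph V) [T.LocallyFinite] (t : ℝ) (z : ℂ) (g : V → Ω → ℝ) 
    (u v : V) (ω : Ω) : ℂ :=
  branchGreen T t z (fun x => g x ω) u v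

/-- The self-energy at `v`, shifted by `z`, so that the branch Green function is
`(g v - randSelf u v)⁻¹`. -/
noncomputable abbrev randSelf {V Ω : Type*} (T : SimpleGraph V) [T.LocallyFinite] (t : ℝ) (z : ℂ) (g : V → Ω → ℝ) 
    (u v : V) (ω : Ω) : ℂ :=
  z + (t : ℂ) ^ 2 * ∑ w ∈ children T u v, randGreen T t z g v w ω

theorem randGreen_eq (hG : ∀ v, T.degree v ≤ d) (hz : 0 < z.im) (u v : V) (ω : Ω) :
    randGreen T t z g u v ω = ((g v ω : ℂ) - randSelf T t z g u v ω)⁻¹ :=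
  branchGreen_eq hG t hz _ u v

theorem im_randGreen_nonneg (hG : ∀ v, T.degree v ≤ d) (hz : 0 < z.im) (u v : V) (ω : Ω) :
    0 ≤ (randGreen T t z g u v ω).im :=
  (admissible_branchGreen hG t hz _ u v).1

theorem im_le_im_randSelf (hG : ∀ v, T.degree v ≤ d) (hz : 0 < z.im) (u v : V) (ω : Ω) :
    z.im ≤ (randSelf T t z g u v ω).im :=
  im_le_im_self_energy t z fun w _ => im_randGreen_nonneg hG hz v w ω

theorem im_randSelf_pos (hG : ∀ v, T.degree v ≤ d) (hz : 0 < z.im) (u v : V) (ω : Ω) :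
    0 < (randSelf T t z g u v ω).im :=
  hz.trans_le (im_le_im_randSelf hG hz u v ω)

theorem im_randGreen_le (hG : ∀ v, T.degree v ≤ d) (hz : 0 < z.im) {u v w : V}
    (hw : w ∈ children T u v) (ω : Ω) :
    t ^ 2 * (randGreen T t z g v w ω).im ≤ (randSelf T t z g u v ω).im := by
  rw [im_self_energy]
  have h := Finset.single_le_sum (f := fun w => (randGreen T t z g v w ω).im)
    (fun w _ => im_randGreen_nonneg hG hz v w ω) hw
  have h2 := mul_le_mul_of_nonneg_left h (sq_nonneg t)
  linarith

theorem im_randSelf_eq (hG : ∀ v, T.degree v ≤ d) (hz : 0 < z.im) (u v : V) (ω : Ω) :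
    (randSelf T t z g u v ω).im = (randGreen T t z g u v ω).im
      * ‖(g v ω : ℂ) - randSelf T t z g u v ω‖ ^ 2 := by
  have h : (0 : ℝ) < ‖(g v ω : ℂ) - randSelf T t z g u v ω‖ :=
    norm_pos_iff.2 (ofReal_sub_ne_zero _ (im_randSelf_pos hG hz u v ω))
  rw [randGreen_eq hG hz u v, im_ofReal_sub_inv, norm_inv]
  field_simp

theorem im_randGreen_pos (hG : ∀ v, T.degree v ≤ d) (hz : 0 < z.im) (u v : V) (ω : Ω) :
    0 < (randGreen T t z g u v ω).im := by
  have h1 := im_randSelf_pos (t := t) (g := g) hG hz u v ω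
  rw [im_randSelf_eq hG hz] at h1
  exact pos_of_mul_pos_left h1 (sq_nonneg _)

theorem sqrt_add_le_sqrt_add_sqrt {a b : ℝ} (ha : 0 ≤ a) (hb : 0 ≤ b) :
    √(a + b) ≤ √a + √b := by
  refine Real.sqrt_le_iff.2 ⟨by positivity, ?_⟩
  nlinarith [Real.sq_sqrt ha, Real.sq_sqrt hb, Real.sqrt_nonneg a, Real.sqrt_nonneg b,
    mul_nonneg (Real.sqrt_nonneg a) (Real.sqrt_nonneg b)]

theorem sqrt_norm_sub_randSelf_le (ht : 0 ≤ t) (u v : V) (ω : Ω) :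
    √‖(g v ω : ℂ) - randSelf T t z g u v ω‖ ≤ √|g v ω| + √‖z‖
      + t * ∑ w ∈ children T u v, √‖randGreen T t z g v w ω‖ := by
  have h1 : ‖(g v ω : ℂ) - randSelf T t z g u v ω‖ ≤ |g v ω| + ‖z‖
      + t ^ 2 * ∑ w ∈ children T u v, ‖randGreen T t z g v w ω‖ := by
    refine (norm_sub_le _ _).trans ?_
    rw [Complex.norm_real, Real.norm_eq_abs, add_assoc]
    gcongr
    refine (norm_add_le _ _).trans ?_
    rw [norm_mul, norm_pow, Complex.norm_real, Real.norm_eq_abs, sq_abs]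
    gcongr
    exact norm_sum_le _ _
  have h2 : √(∑ w ∈ children T u v, ‖randGreen T t z g v w ω‖)
      ≤ ∑ w ∈ children T u v, √‖randGreen T t z g v w ω‖ := by
    generalize children T u v = s
    classical
    induction s using Finset.induction_on with
    | empty => simp
    | insert a s ha ih =>
      rw [Finset.sum_insert ha, Finset.sum_insert ha]
      exact (sqrt_add_le_sqrt_add_sqrt (norm_nonneg _)
        (Finset.sum_nonneg fun _ _ => norm_nonneg _)).trans (by gcongr)
  have h0 : 0 ≤ ∑ w ∈ children T u v, ‖randGreen T t z g v w ω‖ :=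
    Finset.sum_nonneg fun _ _ => norm_nonneg _
  calc √‖(g v ω : ℂ) - randSelf T t z g u v ω‖
      ≤ √(|g v ω| + ‖z‖ + t ^ 2 * ∑ w ∈ children T u v, ‖randGreen T t z g v w ω‖) :=
        Real.sqrt_le_sqrt h1
    _ ≤ √(|g v ω|) + √‖z‖ + √(t ^ 2 * ∑ w ∈ children T u v, ‖randGreen T t z g v w ω‖) :=
        (sqrt_add_le_sqrt_add_sqrt (by positivity) (by positivity)).trans (add_le_add
          (sqrt_add_le_sqrt_add_sqrt (by positivity) (by positivity)) le_rfl)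
    _ ≤ _ := by
        rw [Real.sqrt_mul (sq_nonneg t), Real.sqrt_sq ht]
        gcongr

/-! ### The inverse fractional moment -/

/-- The variable `(Im Γ)^(-1/4)`. The exponent is such that the moment of `|Γ|^(1/2)`, which enters
its recursion, is finite, and that a product of four such variables bounds `(Im S)⁻¹`. -/
noncomputable abbrev invRoot {V Ω : Type*} (T : SimpleGraph V) [T.LocallyFinite] (t : ℝ) (z : ℂ) (g : V → Ω → ℝ) 
    (u v : V) (ω : Ω) : ℝ :=
  (randGreen T t z g u v ω).im ^ (-(1 / 4) : ℝ)

theorem invRoot_eq (hG : ∀ v, T.degree v ≤ d) (hz : 0 < z.im) (u v : V) (ω : Ω) :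
    invRoot T t z g u v ω = √‖(g v ω : ℂ) - randSelf T t z g u v ω‖
      * (randSelf T t z g u v ω).im ^ (-(1 / 4) : ℝ) := by
  have h : (0 : ℝ) < ‖(g v ω : ℂ) - randSelf T t z g u v ω‖ :=
    norm_pos_iff.2 (ofReal_sub_ne_zero _ (im_randSelf_pos hG hz u v ω))
  rw [im_randSelf_eq hG hz, Real.mul_rpow (im_randGreen_nonneg hG hz u v ω) (by positivity),
    ← Real.rpow_natCast, ← Real.rpow_mul h.le, Real.sqrt_eq_rpow, mul_left_comm,
    ← Real.rpow_add h]
  norm_num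

theorem rpow_im_randSelf_le (hG : ∀ v, T.degree v ≤ d) (hz : 0 < z.im) (ht : 0 < t) {u v w : V}
    (hw : w ∈ children T u v) (ω : Ω) :
    (randSelf T t z g u v ω).im ^ (-(1 / 4) : ℝ) ≤ (√t)⁻¹ * invRoot T t z g v w ω := by
  have h1 := im_randGreen_pos (t := t) (g := g) hG hz v w ω
  have h2 : (√t)⁻¹ = (t ^ 2) ^ (-(1 / 4) : ℝ) := by
    rw [← Real.rpow_natCast, ← Real.rpow_mul ht.le, Real.sqrt_eq_rpow, ← Real.rpow_neg ht.le]
    norm_num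
  rw [h2, ← Real.mul_rpow (by positivity) h1.le]
  exact Real.rpow_le_rpow_of_nonpos (by positivity) (im_randGreen_le hG hz hw ω) (by norm_num)

/-- Of two children, either the second one has imaginary part at least `ε`, which bounds the
inverse moment, or the bound by the first one is restricted to an event of small probability. -/
theorem rpow_im_randSelf_le_add (hG : ∀ v, T.degree v ≤ d) (hz : 0 < z.im) (ht : 0 < t)
    {u v j k : V} (hj : j ∈ children T u v) (hk : k ∈ children T u v) {ε : ℝ} (hε : 0 < ε)
    (ω : Ω) :
    (randSelf T t z g u v ω).im ^ (-(1 / 4) : ℝ) ≤ (√t)⁻¹ * (ε ^ (-(1 / 4) : ℝ)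
      + Set.indicator {ω | (randGreen T t z g v k ω).im < ε} (invRoot T t z g v j) ω) := by
  by_cases h : (randGreen T t z g v k ω).im < ε
  · rw [Set.indicator_of_mem (by exact h)]
    refine (rpow_im_randSelf_le hG hz ht hj ω).trans ?_
    gcongr
    exact le_add_of_nonneg_left (by positivity)
  · rw [Set.indicator_of_notMem (by exact h), add_zero]
    refine (rpow_im_randSelf_le hG hz ht hk ω).trans ?_
    gcongr
    exact Real.rpow_le_rpow_of_nonpos hε (not_lt.1 h) (by norm_num)

end RandomBranch

section Moments

variable {V : Type*} {T : SimpleGraph V} [T.LocallyFinite] (hT : T.IsTree)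
  {Ω : Type*} [MeasurableSpace Ω] {P : Measure Ω} [IsProbabilityMeasure P]
  {g : V → Ω → ℝ} {d : ℕ} {t : ℝ} {z : ℂ}

theorem adj_of_mem_children {u v w : V} (hw : w ∈ children T u v) : T.Adj v w :=
  ((mem_children T).1 hw).2

omit [MeasurableSpace Ω] in
theorem measurable_randSelf_siteSigma (hG : ∀ v, T.degree v ≤ d) (hz : 0 < z.im) (u v : V) :
    Measurable[siteSigma g (⋃ w ∈ children T u v, branch hT v w)] (randSelf T t z g u v) := by
  have hsum : Measurable[siteSigma g (⋃ w ∈ children T u v, branch hT v w)]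
      fun ω => ∑ w ∈ children T u v, randGreen T t z g v w ω :=
    @Finset.measurable_fun_sum _ _ _ _ _ _ (siteSigma g _) _ _ fun w hw => ?_
  · have hf : Measurable fun x : ℂ => z + (t : ℂ) ^ 2 * x := by fun_prop
    exact hf.comp hsum
  exact (measurable_branchGreen hT hG t hz (adj_of_mem_children hw)).mono (siteSigma_mono g
    (Set.subset_biUnion_of_mem (u := fun w => branch hT v w) hw)) le_rfl

variable (hG : ∀ v, T.degree v ≤ d) (hz : 0 < z.im) (hg : ∀ v, Measurable (g v))
  (hind : iIndepFun g P) (hglaw : ∀ v, P.map (g v) = gaussianReal 0 1)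

include hT hG hz hg

theorem measurable_randGreen {u v : V} (h : T.Adj u v) : Measurable (randGreen T t z g u v) :=
  (measurable_branchGreen hT hG t hz h).mono (siteSigma_le hg _) le_rfl

theorem measurable_randSelf (u v : V) : Measurable (randSelf T t z g u v) :=
  (measurable_randSelf_siteSigma hT hG hz u v).mono (siteSigma_le hg _) le_rfl

include hind

omit [IsProbabilityMeasure P] in
theorem indepFun_randSelf (u v : V) : IndepFun (g v) (randSelf T t z g u v) P := by
  refine indepFun_of_disjoint hg hind (S := {v}) (S' := ⋃ w ∈ children T u v, branch hT v w)
    ?_ (measurable_siteSigma g rfl) (measurable_randSelf_siteSigma hT hG hz u v)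
  rw [Set.disjoint_singleton_left]
  simp only [Set.mem_iUnion, not_exists]
  exact fun w _ => notMem_branch hT v w

include hglaw

theorem lintegral_sqrt_norm_randGreen_le (u v : V) :
    ∫⁻ ω, ENNReal.ofReal (√‖randGreen T t z g u v ω‖) ∂P ≤ halfMoment := by
  simp only [randGreen_eq hG hz u v]
  exact lintegral_sqrt_norm_inv_le (hg v) (hglaw v) (measurable_randSelf hT hG hz hg u v)
    (indepFun_randSelf hT hG hz hg hind u v)

end Moments

/-! ### Self-consistent inequalities for moments and small values -/

section Constants

/-- A bound on the half moment of `g v - S` for a self-energy `S` with at most `d` branches, shifted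
by a spectral parameter of norm at most `r`. -/
noncomputable def localMoment (t : ℝ) (d : ℕ) (r : ℝ) : ℝ≥0∞ :=
  ∫⁻ x, ENNReal.ofReal (√|x|) ∂(gaussianReal 0 1) + ENNReal.ofReal (√r)
    + ENNReal.ofReal t * (d * halfMoment)

theorem lintegral_sqrt_abs_gaussian_lt_top :
    ∫⁻ x, ENNReal.ofReal (√|x|) ∂(gaussianReal 0 1) < ∞ := by
  have h1 : Integrable (fun x : ℝ => 1 + x ^ 2) (gaussianReal 0 1) :=
    (integrable_const _).add (memLp_id_gaussianReal 2).integrable_sq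
  refine (lintegral_mono fun x => ENNReal.ofReal_le_ofReal ?_).trans_lt h1.lintegral_lt_top
  refine Real.sqrt_le_iff.2 ⟨by positivity, ?_⟩
  rw [← sq_abs x]
  nlinarith [sq_nonneg (|x| ^ 2), sq_nonneg (|x| - 1 / 2)]

theorem localMoment_lt_top (t : ℝ) (d : ℕ) (r : ℝ) : localMoment t d r < ∞ :=
  ENNReal.add_lt_top.2 ⟨ENNReal.add_lt_top.2
    ⟨lintegral_sqrt_abs_gaussian_lt_top, ENNReal.ofReal_lt_top⟩,
    ENNReal.mul_lt_top ENNReal.ofReal_lt_top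
      (ENNReal.mul_lt_top (ENNReal.natCast_lt_top d) halfMoment_lt_top)⟩

end Constants

section Moments

variable {V : Type*} {T : SimpleGraph V} [T.LocallyFinite] (hT : T.IsTree)
  {Ω : Type*} [MeasurableSpace Ω] {P : Measure Ω} [IsProbabilityMeasure P]
  {g : V → Ω → ℝ} {d : ℕ} {t : ℝ} {z : ℂ} {r : ℝ}

omit [IsProbabilityMeasure P] in
/-- The half moment of `g v - S` with respect to a weight `R` that decorrelates, up to a factor
`K`, from the variables at `v` and at each of the branches. -/
theorem lintegral_sqrt_norm_sub_mul_le (hT : T.IsTree) (hG : ∀ v, T.degree v ≤ d) (hz : 0 < z.im)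
    (hr : ‖z‖ ≤ r) (ht : 0 ≤ t) (hg : ∀ v, Measurable (g v)) (u v : V) {R : Ω → ℝ≥0∞}
    (hR : Measurable R) {K : ℝ≥0∞}
    (h0 : ∫⁻ ω, ENNReal.ofReal (√|g v ω|) * R ω ∂P
      ≤ (∫⁻ x, ENNReal.ofReal (√|x|) ∂(gaussianReal 0 1)) * K)
    (h1 : ∫⁻ ω, R ω ∂P ≤ K)
    (h2 : ∀ i ∈ children T u v,
      ∫⁻ ω, ENNReal.ofReal (√‖randGreen T t z g v i ω‖) * R ω ∂P ≤ halfMoment * K) :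
    ∫⁻ ω, ENNReal.ofReal (√‖(g v ω : ℂ) - randSelf T t z g u v ω‖) * R ω ∂P
      ≤ localMoment t d r * K := by
  have hU : ∀ i ∈ children T u v,
      Measurable fun ω => ENNReal.ofReal (√‖randGreen T t z g v i ω‖) * R ω := fun i hi => by
    have := measurable_randGreen (t := t) hT hG hz hg (adj_of_mem_children hi)
    fun_prop
  have hgv := hg v
  calc ∫⁻ ω, ENNReal.ofReal (√‖(g v ω : ℂ) - randSelf T t z g u v ω‖) * R ω ∂P
      ≤ ∫⁻ ω, (ENNReal.ofReal (√|g v ω|) * R ω + ENNReal.ofReal (√r) * R ω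
          + ENNReal.ofReal t * ∑ i ∈ children T u v,
            ENNReal.ofReal (√‖randGreen T t z g v i ω‖) * R ω) ∂P := by
        refine lintegral_mono fun ω => ?_
        rw [← Finset.sum_mul, ← mul_assoc, ← add_mul, ← add_mul]
        refine mul_le_mul' ?_ le_rfl
        rw [← ENNReal.ofReal_sum_of_nonneg fun _ _ => Real.sqrt_nonneg _, ← ENNReal.ofReal_mul ht,
          ← ENNReal.ofReal_add (Real.sqrt_nonneg _) (Real.sqrt_nonneg _),
          ← ENNReal.ofReal_add (by positivity) (mul_nonneg ht
            (Finset.sum_nonneg fun _ _ => Real.sqrt_nonneg _))]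
        refine ENNReal.ofReal_le_ofReal ((sqrt_norm_sub_randSelf_le ht u v ω).trans ?_)
        gcongr
    _ = ∫⁻ ω, ENNReal.ofReal (√|g v ω|) * R ω ∂P + ENNReal.ofReal (√r) * ∫⁻ ω, R ω ∂P
          + ENNReal.ofReal t * ∑ i ∈ children T u v,
            ∫⁻ ω, ENNReal.ofReal (√‖randGreen T t z g v i ω‖) * R ω ∂P := by
        rw [lintegral_add_left (by fun_prop), lintegral_add_left (by fun_prop),
          lintegral_const_mul _ hR, lintegral_const_mul _ (Finset.measurable_fun_sum _ hU),
          lintegral_finsetSum _ hU]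
    _ ≤ (∫⁻ x, ENNReal.ofReal (√|x|) ∂(gaussianReal 0 1)) * K + ENNReal.ofReal (√r) * K
          + ENNReal.ofReal t * (d * (halfMoment * K)) := by
        refine add_le_add (add_le_add h0 (mul_le_mul' le_rfl h1)) (mul_le_mul' le_rfl ?_)
        refine (Finset.sum_le_sum h2).trans ?_
        rw [Finset.sum_const, nsmul_eq_mul]
        refine mul_le_mul' ?_ le_rfl
        exact_mod_cast card_children_le T hG u v
    _ = localMoment t d r * K := by
        rw [localMoment]
        ring

theorem exists_pair_children (hreg : T.IsRegularOfDegree d) (hd : 4 ≤ d) {u v : V}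
    (h : T.Adj u v) (i : V) :
    ∃ j ∈ children T u v, ∃ k ∈ children T u v, j ≠ k ∧ j ≠ i ∧ k ≠ i := by
  classical
  have h1 : 1 < ((children T u v).erase i).card := by
    have := Finset.pred_card_le_card_erase (s := children T u v) (a := i)
    rw [card_children hreg h] at this
    omega
  obtain ⟨j, hj, k, hk, hjk⟩ := Finset.one_lt_card.1 h1
  rw [Finset.mem_erase] at hj hk
  exact ⟨j, hj.2, k, hk.2, hjk, hj.1, hk.1⟩

omit [MeasurableSpace Ω] in
theorem measurable_invRoot_siteSigma (hG : ∀ v, T.degree v ≤ d) (hz : 0 < z.im) {u v : V}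
    (h : T.Adj u v) : Measurable[siteSigma g (branch hT u v)]
      fun ω => ENNReal.ofReal (invRoot T t z g u v ω) := by
  have hf : Measurable fun x : ℂ => ENNReal.ofReal (x.im ^ (-(1 / 4) : ℝ)) := by fun_prop
  exact hf.comp (measurable_branchGreen hT hG t hz h)

omit [T.LocallyFinite] [IsProbabilityMeasure P] in
theorem lintegral_sqrt_abs_eq (hg : ∀ v, Measurable (g v))
    (hglaw : ∀ v, P.map (g v) = gaussianReal 0 1) (v : V) :
    ∫⁻ ω, ENNReal.ofReal (√|g v ω|) ∂P
      = ∫⁻ x, ENNReal.ofReal (√|x|) ∂(gaussianReal 0 1) := by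
  rw [← hglaw v, lintegral_map (by fun_prop) (hg v)]

variable (hreg : T.IsRegularOfDegree d) (hz : 0 < z.im) (hg : ∀ v, Measurable (g v))
  (hind : iIndepFun g P) (hglaw : ∀ v, P.map (g v) = gaussianReal 0 1)

include hT hreg hz hg hind

/-- The expectation of the bound in `rpow_im_randSelf_le_add` against a variable `U` that is
independent of both branches. -/
theorem lintegral_mul_pairBound_eq {v j k : V} (hj : T.Adj v j) (hk : T.Adj v k) (hjk : j ≠ k)
    {S : Set V} (hSj : Disjoint S (branch hT v j)) (hSk : Disjoint S (branch hT v k))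
    {U : Ω → ℝ≥0∞} (hU : Measurable[siteSigma g S] U) (a : ℝ≥0∞) (ε : ℝ) :
    ∫⁻ ω, U ω * (a + Set.indicator {ω | (randGreen T t z g v k ω).im < ε}
        (fun ω => ENNReal.ofReal (invRoot T t z g v j ω)) ω) ∂P
      = (∫⁻ ω, U ω ∂P) * (a + P {ω | (randGreen T t z g v k ω).im < ε}
        * ∫⁻ ω, ENNReal.ofReal (invRoot T t z g v j ω) ∂P) := by
  have hG := fun v => (hreg v).le
  set D : Set Ω := {ω | (randGreen T t z g v k ω).im < ε} with hDdef
  set Y : Ω → ℝ≥0∞ := fun ω => ENNReal.ofReal (invRoot T t z g v j ω) with hYdef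
  have hY : Measurable[siteSigma g (branch hT v j)] Y :=
    measurable_invRoot_siteSigma hT hG hz hj
  have hI : Measurable[siteSigma g (branch hT v k)] (D.indicator (1 : Ω → ℝ≥0∞)) := by
    have hf : Measurable (Set.indicator {x : ℂ | x.im < ε} (1 : ℂ → ℝ≥0∞)) :=
      measurable_one.indicator (measurableSet_lt Complex.measurable_im measurable_const)
    exact hf.comp (measurable_branchGreen hT hG t hz hk)
  have hle := fun S => siteSigma_le hg S
  have hDI : ∀ ω, D.indicator Y ω = D.indicator 1 ω * Y ω := by
    intro ω
    by_cases h : ω ∈ D <;> simp [h]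
  have hDm : MeasurableSet D :=
    measurableSet_lt (Complex.measurable_im.comp (measurable_randGreen hT hG hz hg hk))
      measurable_const
  have hIY : Measurable[siteSigma g (branch hT v j ∪ branch hT v k)]
      fun ω => a + D.indicator Y ω := by
    simp only [hDI]
    have hf : Measurable fun p : ℝ≥0∞ × ℝ≥0∞ => a + p.1 * p.2 := by fun_prop
    exact hf.comp (Measurable.prodMk (hI.mono (siteSigma_mono g Set.subset_union_right) le_rfl)
      (hY.mono (siteSigma_mono g Set.subset_union_left) le_rfl))
  have h1 := lintegral_mul_eq_lintegral_mul_lintegral_of_indepFun (μ := P)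
    (hU.mono (hle _) le_rfl) (hIY.mono (hle _) le_rfl)
    (indepFun_of_disjoint hg hind (Set.disjoint_union_right.2 ⟨hSj, hSk⟩) hU hIY)
  have h2 := lintegral_mul_eq_lintegral_mul_lintegral_of_indepFun (μ := P)
    (hI.mono (hle _) le_rfl) (hY.mono (hle _) le_rfl)
    (indepFun_of_disjoint hg hind (disjoint_branch hT hk hj hjk.symm) hI hY)
  simp only [Pi.mul_apply] at h1 h2
  rw [h1, lintegral_add_left measurable_const, lintegral_const, measure_univ, mul_one]
  simp only [hDI]
  rw [h2, lintegral_indicator_one hDm]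

include hglaw

theorem lintegral_invRoot_eq {u v u' v' : V} (h : T.Adj u v) (h' : T.Adj u' v') :
    ∫⁻ ω, ENNReal.ofReal (invRoot T t z g u v ω) ∂P
      = ∫⁻ ω, ENNReal.ofReal (invRoot T t z g u' v' ω) ∂P :=
  ((identDistrib_branchGreen hT hreg hg hind hglaw t hz h h').comp
    (u := fun x : ℂ => ENNReal.ofReal (x.im ^ (-(1 / 4) : ℝ))) (by fun_prop)).lintegral_eq

theorem measure_im_lt_eq {u v u' v' : V} (h : T.Adj u v) (h' : T.Adj u' v') (ε : ℝ) :
    P {ω | (randGreen T t z g u v ω).im < ε} = P {ω | (randGreen T t z g u' v' ω).im < ε} :=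
  (identDistrib_branchGreen hT hreg hg hind hglaw t hz h h').measure_mem_eq
    (measurableSet_lt Complex.measurable_im measurable_const)

theorem lintegral_sqrt_norm_sub_le (hr : ‖z‖ ≤ r) (ht : 0 ≤ t) (u v : V) :
    ∫⁻ ω, ENNReal.ofReal (√‖(g v ω : ℂ) - randSelf T t z g u v ω‖) ∂P ≤ localMoment t d r := by
  have hG := fun v => (hreg v).le
  have h := lintegral_sqrt_norm_sub_mul_le (P := P) hT hG hz hr ht hg u v (R := 1)
    measurable_one (K := 1) (by
      simp only [Pi.one_apply, mul_one]
      exact (lintegral_sqrt_abs_eq hg hglaw v).le) (by simp) (fun i hi => by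
      simp only [Pi.one_apply, mul_one]
      exact lintegral_sqrt_norm_randGreen_le hT hG hz hg hind hglaw v i)
  simpa using h

theorem lintegral_invRoot_lt_top (ht : 0 ≤ t) (u v : V) :
    ∫⁻ ω, ENNReal.ofReal (invRoot T t z g u v ω) ∂P < ∞ := by
  have hG := fun v => (hreg v).le
  calc ∫⁻ ω, ENNReal.ofReal (invRoot T t z g u v ω) ∂P
      ≤ ∫⁻ ω, ENNReal.ofReal (√‖(g v ω : ℂ) - randSelf T t z g u v ω‖)
          * ENNReal.ofReal (z.im ^ (-(1 / 4) : ℝ)) ∂P := by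
        refine lintegral_mono fun ω => ?_
        rw [← ENNReal.ofReal_mul (Real.sqrt_nonneg _), invRoot_eq hG hz]
        refine ENNReal.ofReal_le_ofReal (mul_le_mul_of_nonneg_left ?_ (Real.sqrt_nonneg _))
        exact Real.rpow_le_rpow_of_nonpos hz (im_le_im_randSelf hG hz u v ω) (by norm_num)
    _ = (∫⁻ ω, ENNReal.ofReal (√‖(g v ω : ℂ) - randSelf T t z g u v ω‖) ∂P)
          * ENNReal.ofReal (z.im ^ (-(1 / 4) : ℝ)) := by
        have h1 := measurable_randSelf (t := t) hT hG hz hg u v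
        have h2 := hg v
        exact lintegral_mul_const _ (by fun_prop)
    _ < ∞ := ENNReal.mul_lt_top ((lintegral_sqrt_norm_sub_le hT hreg hz hg hind hglaw le_rfl ht
        u v).trans_lt (localMoment_lt_top _ _ _)) ENNReal.ofReal_lt_top

/-- The self-consistent inequality for the inverse moment: for every variable among `g v` and the
branch Green functions, two further branches are available to bound the self-energy from below. -/
theorem lintegral_invRoot_le (hd : 4 ≤ d) (hr : ‖z‖ ≤ r) (ht : 0 < t) {u v : V} (h : T.Adj u v)
    {ε : ℝ} (hε : 0 < ε) :
    ∫⁻ ω, ENNReal.ofReal (invRoot T t z g u v ω) ∂P ≤ localMoment t d r *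
      (ENNReal.ofReal (√t)⁻¹ * (ENNReal.ofReal (ε ^ (-(1 / 4) : ℝ))
        + P {ω | (randGreen T t z g u v ω).im < ε}
          * ∫⁻ ω, ENNReal.ofReal (invRoot T t z g u v ω) ∂P)) := by
  have hG := fun v => (hreg v).le
  set m := ∫⁻ ω, ENNReal.ofReal (invRoot T t z g u v ω) ∂P with hm
  set p := P {ω | (randGreen T t z g u v ω).im < ε} with hp
  set a := ENNReal.ofReal (ε ^ (-(1 / 4) : ℝ)) with ha
  set τ := ENNReal.ofReal (√t)⁻¹ with hτ
  have hS := measurable_randSelf (t := t) hT hG hz hg u v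
  have hgv := hg v
  -- the moment of a variable living on `S`, which misses two of the branches
  have key : ∀ (S : Set V) (U : Ω → ℝ≥0∞), Measurable[siteSigma g S] U →
      ∀ j ∈ children T u v, ∀ k ∈ children T u v, j ≠ k → Disjoint S (branch hT v j) →
      Disjoint S (branch hT v k) →
      ∫⁻ ω, U ω * ENNReal.ofReal ((randSelf T t z g u v ω).im ^ (-(1 / 4) : ℝ)) ∂P
        ≤ (∫⁻ ω, U ω ∂P) * (τ * (a + p * m)) := by
    intro S U hU j hj k hk hjk hSj hSk
    have hj' := adj_of_mem_children hj
    have hk' := adj_of_mem_children hk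
    have hU' : Measurable U := hU.mono (siteSigma_le hg _) le_rfl
    calc ∫⁻ ω, U ω * ENNReal.ofReal ((randSelf T t z g u v ω).im ^ (-(1 / 4) : ℝ)) ∂P
        ≤ ∫⁻ ω, τ * (U ω * (a + Set.indicator {ω | (randGreen T t z g v k ω).im < ε}
            (fun ω => ENNReal.ofReal (invRoot T t z g v j ω)) ω)) ∂P := by
          refine lintegral_mono fun ω => ?_
          rw [mul_left_comm]
          refine mul_le_mul' le_rfl ?_
          refine (ENNReal.ofReal_le_ofReal
            (rpow_im_randSelf_le_add hG hz ht hj hk hε ω)).trans_eq ?_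
          rw [ENNReal.ofReal_mul (by positivity), ENNReal.ofReal_add (by positivity)
            (Set.indicator_nonneg (fun ω _ =>
              Real.rpow_nonneg (im_randGreen_nonneg hG hz v j ω) _) ω)]
          congr 2
          by_cases hω : (randGreen T t z g v k ω).im < ε
          · rw [Set.indicator_of_mem (by exact hω), Set.indicator_of_mem (by exact hω)]
          · rw [Set.indicator_of_notMem (by exact hω), Set.indicator_of_notMem (by exact hω),
              ENNReal.ofReal_zero]
      _ = _ := by
          rw [lintegral_const_mul' _ _ ENNReal.ofReal_ne_top,
            lintegral_mul_pairBound_eq hT hreg hz hg hind hj' hk' hjk hSj hSk hU,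
            measure_im_lt_eq hT hreg hz hg hind hglaw hk' h,
            lintegral_invRoot_eq hT hreg hz hg hind hglaw hj' h]
          ring
  have hgsing : ∀ w, Disjoint {v} (branch hT v w) := fun w =>
    Set.disjoint_singleton_left.2 (notMem_branch hT v w)
  obtain ⟨j, hj, k, hk, hjk, -, -⟩ := exists_pair_children hreg hd h v
  have hf : Measurable fun x : ℂ => ENNReal.ofReal (x.im ^ (-(1 / 4) : ℝ)) := by fun_prop
  have hmain := lintegral_sqrt_norm_sub_mul_le (P := P) hT hG hz hr ht.le hg u v
    (R := fun ω => ENNReal.ofReal ((randSelf T t z g u v ω).im ^ (-(1 / 4) : ℝ)))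
    (hf.comp hS) (K := τ * (a + p * m)) ?_ ?_ ?_
  · refine le_trans (lintegral_mono fun ω => ?_) hmain
    rw [← ENNReal.ofReal_mul (Real.sqrt_nonneg _), invRoot_eq hG hz]
  · have hf : Measurable fun x : ℝ => ENNReal.ofReal (√|x|) := by fun_prop
    have := key {v} (fun ω => ENNReal.ofReal (√|g v ω|))
      (hf.comp (measurable_siteSigma g rfl)) j hj k hk hjk (hgsing j) (hgsing k)
    rwa [lintegral_sqrt_abs_eq hg hglaw v] at this
  · have := key ∅ (fun _ => 1) measurable_const j hj k hk hjk (Set.empty_disjoint _)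
      (Set.empty_disjoint _)
    simpa using this
  · intro i hi
    obtain ⟨j, hj, k, hk, hjk, hji, hki⟩ := exists_pair_children hreg hd h i
    have hi' := adj_of_mem_children hi
    have hf : Measurable fun x : ℂ => ENNReal.ofReal (√‖x‖) := by fun_prop
    have := key (branch hT v i) (fun ω => ENNReal.ofReal (√‖randGreen T t z g v i ω‖))
      (hf.comp (measurable_branchGreen hT hG t hz hi')) j hj k hk hjk
      (disjoint_branch hT hi' (adj_of_mem_children hj) hji.symm)
      (disjoint_branch hT hi' (adj_of_mem_children hk) hki.symm)
    refine this.trans (mul_le_mul' ?_ le_rfl)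
    exact lintegral_sqrt_norm_randGreen_le hT hG hz hg hind hglaw v i

/-- If `Im Γ` is very small at `v`, then either `g v - S` is large or `Im Γ` is small at two
independent children. -/
theorem measure_im_lt_le (hd : 4 ≤ d) (hr : ‖z‖ ≤ r) (ht : 0 < t) {u v : V} (h : T.Adj u v)
    {ε L : ℝ} (hL : 0 < L) :
    P.real {ω | (randGreen T t z g u v ω).im < ε * (t ^ 2 / L ^ 4)}
      ≤ (localMoment t d r).toReal / L + P.real {ω | (randGreen T t z g u v ω).im < ε} ^ 2 := by
  have hG := fun v => (hreg v).le
  obtain ⟨j, hj, k, hk, hjk, -, -⟩ := exists_pair_children hreg hd h v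
  have hj' := adj_of_mem_children hj
  have hk' := adj_of_mem_children hk
  have hS := measurable_randSelf (t := t) hT hG hz hg u v
  have hgv := hg v
  set N : Ω → ℝ≥0∞ := fun ω => ENNReal.ofReal (√‖(g v ω : ℂ) - randSelf T t z g u v ω‖) with hN
  have hNm : Measurable N := by fun_prop
  have hsub : {ω | (randGreen T t z g u v ω).im < ε * (t ^ 2 / L ^ 4)} ⊆
      {ω | ENNReal.ofReal L ≤ N ω} ∪ ((randGreen T t z g v j) ⁻¹' {x | x.im < ε} ∩
        (randGreen T t z g v k) ⁻¹' {x | x.im < ε}) := by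
    intro ω hω
    by_cases hNL : ENNReal.ofReal L ≤ N ω
    · exact Or.inl hNL
    · right
      rw [not_le, hN, ENNReal.ofReal_lt_ofReal_iff hL] at hNL
      rw [Real.sqrt_lt' hL] at hNL
      have h1 : ‖(g v ω : ℂ) - randSelf T t z g u v ω‖ ^ 2 ≤ L ^ 4 := by
        calc _ ≤ (L ^ 2) ^ 2 := by gcongr
          _ = L ^ 4 := by ring
      have h2 : (randSelf T t z g u v ω).im < t ^ 2 * ε := by
        rw [im_randSelf_eq hG hz]
        calc _ ≤ (randGreen T t z g u v ω).im * L ^ 4 :=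
              mul_le_mul_of_nonneg_left h1 (im_randGreen_nonneg hG hz u v ω)
          _ < ε * (t ^ 2 / L ^ 4) * L ^ 4 := by
              gcongr
              exact hω
          _ = t ^ 2 * ε := by
              field_simp
      have h3 : ∀ w ∈ children T u v, (randGreen T t z g v w ω).im < ε := fun w hw =>
        lt_of_mul_lt_mul_left ((im_randGreen_le hG hz hw ω).trans_lt h2) (sq_nonneg t)
      exact ⟨h3 j hj, h3 k hk⟩
  have hms : MeasurableSet {x : ℂ | x.im < ε} :=
    measurableSet_lt Complex.measurable_im measurable_const
  have hind2 : IndepFun (randGreen T t z g v j) (randGreen T t z g v k) P :=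
    indepFun_of_disjoint hg hind (disjoint_branch hT hj' hk' hjk)
      (measurable_branchGreen hT hG t hz hj') (measurable_branchGreen hT hG t hz hk')
  have h2 := hind2.measure_inter_preimage_eq_mul _ _ hms hms
  have h3 : ∀ w, T.Adj v w → P ((randGreen T t z g v w) ⁻¹' {x | x.im < ε})
      = P {ω | (randGreen T t z g u v ω).im < ε} := fun w hw =>
    measure_im_lt_eq hT hreg hz hg hind hglaw hw h ε
  rw [h3 j hj', h3 k hk'] at h2
  have h4 : P {ω | ENNReal.ofReal L ≤ N ω} ≤ localMoment t d r / ENNReal.ofReal L := by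
    rw [ENNReal.le_div_iff_mul_le (Or.inl (by simpa using hL)) (Or.inl ENNReal.ofReal_ne_top),
      mul_comm]
    exact (mul_meas_ge_le_lintegral hNm _).trans
      (lintegral_sqrt_norm_sub_le hT hreg hz hg hind hglaw hr ht.le u v)
  have h5 := (measure_mono (μ := P) hsub).trans ((measure_union_le _ _).trans
    (add_le_add h4 h2.le))
  have hfin : localMoment t d r / ENNReal.ofReal L ≠ ∞ :=
    ENNReal.div_ne_top (localMoment_lt_top t d r).ne (by simpa using hL)
  have h6 := ENNReal.toReal_mono
    (ENNReal.add_ne_top.2 ⟨hfin, ENNReal.mul_ne_top (measure_ne_top _ _) (measure_ne_top _ _)⟩) h5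
  rw [ENNReal.toReal_add hfin (ENNReal.mul_ne_top (measure_ne_top _ _) (measure_ne_top _ _)),
    ENNReal.toReal_div, ENNReal.toReal_ofReal hL.le, ENNReal.toReal_mul] at h6
  refine h6.trans_eq ?_
  rw [sq (P.real _)]
  rfl

/-- Averaging over the potential at the root leaves the inverse of the self-energy, which the
inverse fractional moments of four branches control. -/
theorem lintegral_im_sq_le (hd : 4 ≤ d) (ht : 0 < t) {u v : V} (h : T.Adj u v) (o : V) :
    ∫⁻ ω, ENNReal.ofReal ((randGreen T t z g o o ω).im ^ 2) ∂P ≤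
      ENNReal.ofReal (Real.pi / t ^ 2)
        * (∫⁻ ω, ENNReal.ofReal (invRoot T t z g u v ω) ∂P) ^ 4 := by
  classical
  have hG := fun v => (hreg v).le
  have hcard : 4 ≤ (children T o o).card := by
    rw [children, Finset.erase_eq_of_notMem (by simp), T.card_neighborFinset_eq_degree, hreg o]
    exact hd
  obtain ⟨W, hW, hW4⟩ := Finset.exists_subset_card_eq hcard
  have hadj : ∀ w ∈ W, T.Adj o w := fun w hw => adj_of_mem_children (hW hw)
  set Y : V → Ω → ℝ≥0∞ := fun w ω => ENNReal.ofReal (invRoot T t z g o w ω) with hYdef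
  have hY : ∀ w ∈ W, Measurable[siteSigma g (branch hT o w)] (Y w) := fun w hw =>
    measurable_invRoot_siteSigma hT hG hz (hadj w hw)
  have hprod : ∀ s ⊆ W, ∫⁻ ω, ∏ w ∈ s, Y w ω ∂P
      = (∫⁻ ω, ENNReal.ofReal (invRoot T t z g u v ω) ∂P) ^ s.card := by
    intro s
    induction s using Finset.induction_on with
    | empty => simp
    | insert a s ha ih =>
      intro hs
      have haW := hs (Finset.mem_insert_self a s)
      have hsW : s ⊆ W := (Finset.subset_insert a s).trans hs
      have hm : Measurable[siteSigma g (⋃ w ∈ s, branch hT o w)] fun ω => ∏ w ∈ s, Y w ω := by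
        refine @Finset.measurable_fun_prod _ _ _ _ _ _ (siteSigma g _) _ _ fun w hw => ?_
        exact (hY w (hsW hw)).mono (siteSigma_mono g
          (Set.subset_biUnion_of_mem (u := fun w => branch hT o w) hw)) le_rfl
      have hdisj : Disjoint (branch hT o a) (⋃ w ∈ s, branch hT o w) := by
        rw [Set.disjoint_iUnion₂_right]
        exact fun w hw => disjoint_branch hT (hadj a haW) (hadj w (hsW hw)) fun h => ha (h ▸ hw)
      have h1 := lintegral_mul_eq_lintegral_mul_lintegral_of_indepFun (μ := P)
        ((hY a haW).mono (siteSigma_le hg _) le_rfl) (hm.mono (siteSigma_le hg _) le_rfl)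
        (indepFun_of_disjoint hg hind hdisj (hY a haW) hm)
      simp only [Pi.mul_apply] at h1
      simp only [Finset.prod_insert ha]
      rw [h1, ih hsW, Finset.card_insert_of_notMem ha, pow_succ', hYdef,
        lintegral_invRoot_eq hT hreg hz hg hind hglaw (hadj a haW) h]
  have hpt : ∀ ω, ENNReal.ofReal (Real.pi / (randSelf T t z g o o ω).im)
      ≤ ENNReal.ofReal (Real.pi / t ^ 2) * ∏ w ∈ W, Y w ω := by
    intro ω
    have hSpos := im_randSelf_pos (t := t) (g := g) hG hz o o ω
    rw [← ENNReal.ofReal_prod_of_nonneg fun w _ =>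
      Real.rpow_nonneg (im_randGreen_nonneg hG hz o w ω) _, ← ENNReal.ofReal_mul (by positivity)]
    refine ENNReal.ofReal_le_ofReal ?_
    have h1 : ∏ _w ∈ W, ((randSelf T t z g o o ω).im / t ^ 2) ^ (-(1 / 4) : ℝ)
        ≤ ∏ w ∈ W, invRoot T t z g o w ω := by
      refine Finset.prod_le_prod (fun w _ => by positivity) fun w hw => ?_
      refine Real.rpow_le_rpow_of_nonpos (im_randGreen_pos hG hz o w ω) ?_ (by norm_num)
      rw [le_div_iff₀' (by positivity)]
      exact im_randGreen_le hG hz (hW hw) ω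
    rw [Finset.prod_const, hW4, ← Real.rpow_natCast, ← Real.rpow_mul (by positivity)] at h1
    have h2 : ((randSelf T t z g o o ω).im / t ^ 2) ^ (-(1 / 4) * ((4 : ℕ) : ℝ) : ℝ)
        = t ^ 2 / (randSelf T t z g o o ω).im := by
      norm_num [Real.rpow_neg_one]
    rw [h2] at h1
    calc Real.pi / (randSelf T t z g o o ω).im
        = Real.pi / t ^ 2 * (t ^ 2 / (randSelf T t z g o o ω).im) := by
          field_simp
      _ ≤ _ := by gcongr
  calc ∫⁻ ω, ENNReal.ofReal ((randGreen T t z g o o ω).im ^ 2) ∂P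
      ≤ ∫⁻ ω, ENNReal.ofReal (Real.pi / (randSelf T t z g o o ω).im) ∂P := by
        simp only [randGreen_eq hG hz o o]
        exact lintegral_im_inv_sq_le (hg o) (hglaw o) (measurable_randSelf hT hG hz hg o o)
          (indepFun_randSelf hT hG hz hg hind o o) fun ω => im_randSelf_pos hG hz o o ω
    _ ≤ ∫⁻ ω, ENNReal.ofReal (Real.pi / t ^ 2) * ∏ w ∈ W, Y w ω ∂P := lintegral_mono hpt
    _ = _ := by
        rw [lintegral_const_mul' _ _ ENNReal.ofReal_ne_top, hprod W subset_rfl, hW4]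

/-- A lower bound on the probability that the Green function at the root has imaginary part above
`c` transfers to the branches: the self-energy cannot be too small, so that some branch
contributes. -/
theorem measure_im_lt_le_of_root (ht : 0 < t) (hd : 0 < d) {u v : V} (h : T.Adj u v) (o : V)
    {c : ℝ} (hc : 0 < c) (hη : z.im ≤ c ^ 3 / 32)
    (hroot : ENNReal.ofReal c < P {ω | c < (randGreen T t z g o o ω).im}) :
    P.real {ω | (randGreen T t z g u v ω).im < c ^ 3 / (32 * t ^ 2 * d)} ≤ 1 - c / (2 * d) := by
  have hG := fun v => (hreg v).le
  have hd' : (0 : ℝ) < d := by exact_mod_cast hd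
  set ε := c ^ 3 / (32 * t ^ 2 * d) with hε
  have hsub : {ω | c < (randGreen T t z g o o ω).im} ⊆
      {ω | c < (((g o ω : ℂ) - randSelf T t z g o o ω)⁻¹).im
        ∧ (randSelf T t z g o o ω).im ≤ c ^ 3 / 16}
      ∪ ⋃ w ∈ children T o o, {ω | (randGreen T t z g o w ω).im < ε}ᶜ := by
    intro ω hω
    by_cases h1 : (randSelf T t z g o o ω).im ≤ c ^ 3 / 16
    · left
      refine ⟨?_, h1⟩
      rw [← randGreen_eq hG hz]
      exact hω
    · right
      by_contra h2
      simp only [Set.mem_iUnion, not_exists, Set.mem_compl_iff, not_not] at h2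
      have h3 : ∑ w ∈ children T o o, (randGreen T t z g o w ω).im ≤ d * ε := by
        calc _ ≤ ∑ w ∈ children T o o, ε := Finset.sum_le_sum fun w hw => (h2 w hw).le
          _ = (children T o o).card * ε := by rw [Finset.sum_const, nsmul_eq_mul]
          _ ≤ d * ε := by
              gcongr
              exact card_children_le T hG o o
      have h4 : t ^ 2 * (d * ε) = c ^ 3 / 32 := by
        rw [hε]
        field_simp
      rw [im_self_energy] at h1
      have h5 := mul_le_mul_of_nonneg_left h3 (sq_nonneg t)
      refine h1 ?_
      linarith
  have h1 : P {ω | c < (((g o ω : ℂ) - randSelf T t z g o o ω)⁻¹).im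
      ∧ (randSelf T t z g o o ω).im ≤ c ^ 3 / 16} ≤ ENNReal.ofReal (c / 2) := by
    refine (measure_im_inv_gt_le (hg o) (hglaw o) (measurable_randSelf hT hG hz hg o o)
      (indepFun_randSelf hT hG hz hg hind o o) hc).trans_eq ?_
    have : c ^ 3 / 16 / c = (c / 4) ^ 2 := by
      field_simp
      norm_num
    rw [this, Real.sqrt_sq (by positivity)]
    congr 1
    ring
  have hms : ∀ u v, T.Adj u v → MeasurableSet {ω | (randGreen T t z g u v ω).im < ε} :=
    fun u v h => measurableSet_lt (Complex.measurable_im.comp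
      (measurable_randGreen hT hG hz hg h)) measurable_const
  have h2 : P (⋃ w ∈ children T o o, {ω | (randGreen T t z g o w ω).im < ε}ᶜ)
      ≤ d * P {ω | (randGreen T t z g u v ω).im < ε}ᶜ := by
    refine (measure_biUnion_finset_le _ _).trans ?_
    have h3 : ∀ w ∈ children T o o, P {ω | (randGreen T t z g o w ω).im < ε}ᶜ
        = P {ω | (randGreen T t z g u v ω).im < ε}ᶜ := by
      intro w hw
      have hw' := adj_of_mem_children hw
      rw [prob_compl_eq_one_sub (hms o w hw'), prob_compl_eq_one_sub (hms u v h),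
        measure_im_lt_eq hT hreg hz hg hind hglaw hw' h]
    rw [Finset.sum_congr rfl h3, Finset.sum_const, nsmul_eq_mul]
    refine mul_le_mul' ?_ le_rfl
    exact_mod_cast card_children_le T hG o o
  have h3 := hroot.le.trans ((measure_mono hsub).trans ((measure_union_le _ _).trans
    (add_le_add h1 h2)))
  have hfin : (d : ℝ≥0∞) * P {ω | (randGreen T t z g u v ω).im < ε}ᶜ ≠ ∞ :=
    ENNReal.mul_ne_top (ENNReal.natCast_ne_top d) (measure_ne_top _ _)
  have h4 := ENNReal.toReal_mono (ENNReal.add_ne_top.2 ⟨ENNReal.ofReal_ne_top, hfin⟩) h3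
  rw [ENNReal.toReal_add ENNReal.ofReal_ne_top hfin, ENNReal.toReal_ofReal hc.le,
    ENNReal.toReal_ofReal (by positivity), ENNReal.toReal_mul, ENNReal.toReal_natCast] at h4
  change c ≤ c / 2 + d * P.real {ω | (randGreen T t z g u v ω).im < ε}ᶜ at h4
  rw [probReal_compl_eq_one_sub (hms u v h)] at h4
  have h5 : c / (2 * d) ≤ 1 - P.real {ω | (randGreen T t z g u v ω).im < ε} := by
    rw [div_le_iff₀ (by positivity)]
    linarith
  linarith

end Moments

/-! ### Uniformity in the imaginary part of the spectral parameter -/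

/-- A bound on small-ball probabilities `F` by their squares at a larger scale forces them to
vanish at small scales, since the infimum `q` satisfies `q ≤ q²`. -/
theorem exists_lt_of_le_sq {F : ℝ → ℝ} (hF0 : ∀ ε, 0 ≤ F ε) {a C : ℝ} (ha : 0 < a) (hC : 0 ≤ C)
    (hF : ∀ ε L, 0 < ε → 0 < L → F (ε * (a / L ^ 4)) ≤ C / L + F ε ^ 2) {ε₀ : ℝ} (hε₀ : 0 < ε₀)
    (h1 : F ε₀ < 1) {q : ℝ} (hq : 0 < q) : ∃ ε, 0 < ε ∧ F ε < q := by
  by_contra! hcon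
  set I := sInf (F '' Set.Ioi 0) with hI
  have hbdd : BddBelow (F '' Set.Ioi 0) := ⟨0, by
    rintro _ ⟨ε, -, rfl⟩
    exact hF0 ε⟩
  have hIle : ∀ ε, 0 < ε → I ≤ F ε := fun ε hε => csInf_le hbdd ⟨ε, hε, rfl⟩
  have hIq : q ≤ I := le_csInf ⟨_, Set.mem_image_of_mem F hε₀⟩ (by
    rintro _ ⟨ε, hε, rfl⟩
    exact hcon ε hε)
  have hI0 : 0 < I := hq.trans_le hIq
  have hI1 : I < 1 := (hIle ε₀ hε₀).trans_lt h1
  have hlt : I < √I := by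
    rw [Real.lt_sqrt hI0.le]
    nlinarith
  obtain ⟨_, ⟨ε, hε, rfl⟩, hεI⟩ := exists_lt_of_csInf_lt ⟨_, Set.mem_image_of_mem F hε₀⟩ hlt
  have h2 : F ε ^ 2 < I := (Real.lt_sqrt (hF0 ε)).1 hεI
  have hgap : 0 < I - F ε ^ 2 := sub_pos.2 h2
  set L := (C + 1) / (I - F ε ^ 2) with hL
  have hL0 : 0 < L := by positivity
  have h3 := hF ε L hε hL0
  have h4 : C / L < I - F ε ^ 2 := by
    rw [div_lt_iff₀ hL0, hL, mul_div_cancel₀ _ hgap.ne']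
    linarith
  have hε' : 0 < ε := hε
  have h5 := hIle (ε * (a / L ^ 4)) (by positivity)
  linarith

theorem le_two_mul_of_le_add_half {m A B p : ℝ≥0∞} (hm : m < ∞) (h : m ≤ A + B * p * m)
    (hBp : B * p ≤ 1 / 2) : m ≤ 2 * A := by
  have h1 : m ≤ A + m / 2 := h.trans (by
    gcongr
    rw [div_eq_mul_inv, mul_comm m]
    gcongr
    simpa using hBp)
  have h2 : m / 2 ≠ ∞ := ENNReal.div_ne_top hm.ne two_ne_zero
  have h3 : m / 2 ≤ A := by
    refine (ENNReal.add_le_add_iff_right h2).1 ?_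
    rwa [ENNReal.add_halves]
  calc m = 2 * (m / 2) := (ENNReal.mul_div_cancel two_ne_zero ENNReal.ofNat_ne_top).symm
    _ ≤ 2 * A := by gcongr

theorem norm_spectral_le {E η : ℝ} (hη : 0 < η) (hη1 : η ≤ 1) :
    ‖(E : ℂ) + η * Complex.I‖ ≤ |E| + 1 := by
  refine (norm_add_le _ _).trans ?_
  rw [norm_mul, Complex.norm_I, mul_one, Complex.norm_real, Complex.norm_real, Real.norm_eq_abs,
    Real.norm_eq_abs, abs_of_pos hη]
  gcongr

theorem im_spectral (E η : ℝ) : ((E : ℂ) + η * Complex.I).im = η := by simp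

section Uniform

variable {V : Type*} {T : SimpleGraph V} [T.LocallyFinite]
  {Ω : Type*} [MeasurableSpace Ω] {P : Measure Ω} [IsProbabilityMeasure P]
  {g : V → Ω → ℝ} {d : ℕ} {t : ℝ}

/-- If the imaginary part of the Green function at the root does not vanish in probability as
`η → 0`, then the inverse fractional moments of the branches stay bounded. -/
theorem exists_lintegral_invRoot_le (hT : T.IsTree) (hreg : T.IsRegularOfDegree d) (hd : 4 ≤ d)
    (hg : ∀ v, Measurable (g v)) (hind : iIndepFun g P)
    (hglaw : ∀ v, P.map (g v) = gaussianReal 0 1) (E : ℝ) (ht : 0 < t) {u v : V} (h : T.Adj u v)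
    (o : V) {c η₀ : ℝ} (hc : 0 < c) (hη₀ : 0 < η₀)
    (hroot : ∀ η : ℝ, 0 < η → η < η₀ →
      ENNReal.ofReal c < P {ω | c < (randGreen T t (E + η * Complex.I) g o o ω).im}) :
    ∃ η₁ : ℝ, 0 < η₁ ∧ ∃ M : ℝ≥0∞, M < ∞ ∧ ∀ η : ℝ, 0 < η → η < η₁ →
      ∫⁻ ω, ENNReal.ofReal (invRoot T t (E + η * Complex.I) g u v ω) ∂P ≤ M := by
  set η₁ := min η₀ (min 1 (c ^ 3 / 32)) with hη₁
  have hη₁0 : 0 < η₁ := by positivity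
  set r := |E| + 1 with hr
  set S : ℝ → Set ℝ := fun ε =>
    (fun η : ℝ => P.real {ω | (randGreen T t (E + η * Complex.I) g u v ω).im < ε})
      '' Set.Ioo 0 η₁ with hS
  have hne : ∀ ε, (S ε).Nonempty := fun ε => (Set.nonempty_Ioo.2 hη₁0).image _
  have hbdd : ∀ ε, BddAbove (S ε) := fun ε => ⟨1, by
    rintro _ ⟨η, -, rfl⟩
    exact measureReal_le_one⟩
  set F : ℝ → ℝ := fun ε => sSup (S ε) with hFdef
  have hle : ∀ ε η, η ∈ Set.Ioo 0 η₁ →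
      P.real {ω | (randGreen T t (E + η * Complex.I) g u v ω).im < ε} ≤ F ε :=
    fun ε η hη => le_csSup (hbdd ε) ⟨η, hη, rfl⟩
  have hF0 : ∀ ε, 0 ≤ F ε := fun ε => by
    obtain ⟨η, hη⟩ := Set.nonempty_Ioo.2 hη₁0
    exact measureReal_nonneg.trans (hle ε η hη)
  have hz : ∀ η ∈ Set.Ioo 0 η₁, 0 < ((E : ℂ) + η * Complex.I).im := fun η hη => by
    rw [im_spectral]
    exact hη.1
  have hzr : ∀ η ∈ Set.Ioo 0 η₁, ‖(E : ℂ) + η * Complex.I‖ ≤ r := fun η hη =>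
    norm_spectral_le hη.1 (hη.2.le.trans ((min_le_right _ _).trans (min_le_left _ _)))
  have hd0 : 0 < d := by omega
  have hd' : (0 : ℝ) < d := by exact_mod_cast hd0
  have hFsq : ∀ ε L, 0 < ε → 0 < L →
      F (ε * (t ^ 2 / L ^ 4)) ≤ (localMoment t d r).toReal / L + F ε ^ 2 := by
    intro ε L hε hL
    refine csSup_le (hne _) ?_
    rintro _ ⟨η, hη, rfl⟩
    refine (measure_im_lt_le hT hreg (hz η hη) hg hind hglaw hd (hzr η hη) ht h hL).trans ?_
    have := hle ε η hη
    have h0 : 0 ≤ P.real {ω | (randGreen T t (E + η * Complex.I) g u v ω).im < ε} :=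
      measureReal_nonneg
    gcongr
  have hFlt : F (c ^ 3 / (32 * t ^ 2 * d)) < 1 := by
    have : F (c ^ 3 / (32 * t ^ 2 * d)) ≤ 1 - c / (2 * d) := by
      refine csSup_le (hne _) ?_
      rintro _ ⟨η, hη, rfl⟩
      refine measure_im_lt_le_of_root hT hreg (hz η hη) hg hind hglaw ht hd0 h o hc ?_
        (hroot η hη.1 (hη.2.trans_le (min_le_left _ _)))
      rw [im_spectral]
      exact hη.2.le.trans ((min_le_right _ _).trans (min_le_right _ _))
    have h2 : 0 < c / (2 * d) := by positivity
    linarith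
  set K := localMoment t d r * ENNReal.ofReal (√t)⁻¹ with hK
  have hKtop : K < ∞ := ENNReal.mul_lt_top (localMoment_lt_top _ _ _) ENNReal.ofReal_lt_top
  -- the threshold below which `K` times the small-ball probability is at most one half
  obtain ⟨ε, hε, hFε⟩ := exists_lt_of_le_sq hF0 (pow_pos ht 2) ENNReal.toReal_nonneg hFsq
    (by positivity) hFlt (q := 1 / (2 * (K.toReal + 1)))
    (by have := ENNReal.toReal_nonneg (a := K); positivity)
  refine ⟨η₁, hη₁0, 2 * (K * ENNReal.ofReal (ε ^ (-(1 / 4) : ℝ))),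
    ENNReal.mul_lt_top ENNReal.ofNat_lt_top (ENNReal.mul_lt_top hKtop ENNReal.ofReal_lt_top), ?_⟩
  intro η h1 h2
  have hη : η ∈ Set.Ioo 0 η₁ := ⟨h1, h2⟩
  refine le_two_mul_of_le_add_half (B := K)
    (p := P {ω | (randGreen T t (E + η * Complex.I) g u v ω).im < ε})
    (lintegral_invRoot_lt_top hT hreg (hz η hη) hg hind hglaw ht.le u v) ?_ ?_
  · refine (lintegral_invRoot_le hT hreg (hz η hη) hg hind hglaw hd (hzr η hη) ht h hε).trans_eq ?_
    rw [hK]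
    ring
  · have hp := (hle ε η hη).trans hFε.le
    have hK0 := ENNReal.toReal_nonneg (a := K)
    rw [← ENNReal.ofReal_toReal hKtop.ne, ← ofReal_measureReal, ← ENNReal.ofReal_mul hK0]
    have h3 : (1 / 2 : ℝ≥0∞) = ENNReal.ofReal (1 / 2) := by
      rw [ENNReal.ofReal_div_of_pos two_pos]
      simp
    rw [h3]
    refine ENNReal.ofReal_le_ofReal ?_
    calc K.toReal * P.real {ω | (randGreen T t (E + η * Complex.I) g u v ω).im < ε}
        ≤ K.toReal * (1 / (2 * (K.toReal + 1))) := by gcongr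
      _ ≤ 1 / 2 := by
          rw [mul_one_div, div_le_div_iff₀ (by positivity) two_pos]
          linarith

end Uniform

end TreeAnderson

theorem lemma3p5 {V : Type*} (T : SimpleGraph V) [T.LocallyFinite] (hT : T.IsTree)
    {d : ℕ} (hd : 10 ≤ d) (hreg : T.IsRegularOfDegree d) (o : V)
    {Ω : Type*} [MeasurableSpace Ω] (P : Measure Ω) [IsProbabilityMeasure P]
    (g : V → Ω → ℝ) (hg_meas : ∀ v, Measurable (g v))
    (hg_law : ∀ v, P.map (g v) = gaussianReal 0 1) (hg_indep : iIndepFun g P)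
    (E t : ℝ) (ht : 0 < t)
    (hyp : ∃ c : ℝ, 0 < c ∧ ENNReal.ofReal c <
      Filter.liminf (fun η : ℝ => P {ω | c < (TreeAnderson.resolventEntry T (fun v => (hreg v).le)
        t (fun v => g v ω) o (E + η * Complex.I)).im}) (𝓝[>] (0 : ℝ))) :
    (⨆ η ∈ Set.Ioc (0 : ℝ) 1, ∫⁻ ω, ENNReal.ofReal ((TreeAnderson.resolventEntry T
      (fun v => (hreg v).le) t (fun v => g v ω) o (E + η * Complex.I)).im ^ 2) ∂P) <
        (∞ : ℝ≥0∞) := by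
  obtain ⟨c, hc, hlim⟩ := hyp
  have hG : ∀ v, T.degree v ≤ d := fun v => (hreg v).le
  have hz : ∀ η : ℝ, 0 < η → 0 < ((E : ℂ) + η * Complex.I).im := fun η hη => by
    rwa [TreeAnderson.im_spectral]
  have hres : ∀ η : ℝ, 0 < η → ∀ ω, TreeAnderson.resolventEntry T (fun v => (hreg v).le) t
      (fun v => g v ω) o (E + η * Complex.I)
        = TreeAnderson.randGreen T t (E + η * Complex.I) g o o ω := fun η hη ω =>
    TreeAnderson.resolventEntry_eq_branchGreen hT hG (hz η hη) o
  have hev := Filter.eventually_lt_of_lt_liminf hlim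
  obtain ⟨η₀, hη₀, hsub⟩ := mem_nhdsGT_iff_exists_Ioo_subset.1 hev
  have hη₀' : 0 < η₀ := hη₀
  have hroot : ∀ η : ℝ, 0 < η → η < η₀ → ENNReal.ofReal c
      < P {ω | c < (TreeAnderson.randGreen T t (E + η * Complex.I) g o o ω).im} := by
    intro η h1 h2
    have h3 := hsub ⟨h1, h2⟩
    simp only [Set.mem_ofPred_eq, hres η h1] at h3
    exact h3
  obtain ⟨v, hv⟩ : ∃ v, T.Adj o v := by
    rw [← T.degree_pos_iff_exists_adj, hreg o]
    omega
  obtain ⟨η₁, hη₁, M, hM, hbound⟩ := TreeAnderson.exists_lintegral_invRoot_le hT hreg (by omega)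
    hg_meas hg_indep hg_law E ht hv o hc hη₀' hroot
  have hA : ENNReal.ofReal (Real.pi / t ^ 2) * M ^ 4 < ∞ :=
    ENNReal.mul_lt_top ENNReal.ofReal_lt_top (ENNReal.pow_lt_top hM)
  refine lt_of_le_of_lt (iSup₂_le fun η hη => ?_)
    (max_lt hA (ENNReal.ofReal_lt_top (r := (η₁⁻¹) ^ 2)))
  simp only [hres η hη.1]
  rcases lt_or_ge η η₁ with h | h
  · refine le_max_of_le_left ?_
    refine (TreeAnderson.lintegral_im_sq_le hT hreg (hz η hη.1) hg_meas hg_indep hg_law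
      (by omega) ht hv o).trans ?_
    gcongr
    exact hbound η hη.1 h
  · refine le_max_of_le_right ?_
    -- away from the real axis the resolvent is bounded deterministically
    calc _ ≤ ∫⁻ _ω, ENNReal.ofReal ((η₁⁻¹) ^ 2) ∂P := by
          refine lintegral_mono fun ω => ENNReal.ofReal_le_ofReal ?_
          have h1 := TreeAnderson.admissible_branchGreen hG t (hz η hη.1) (fun x => g x ω) o o
          have h2 : (TreeAnderson.randGreen T t (E + η * Complex.I) g o o ω).im ≤ η₁⁻¹ := by
            refine (le_abs_self _).trans ((Complex.abs_im_le_norm _).trans (h1.2.trans ?_))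
            rw [TreeAnderson.im_spectral]
            gcongr
          exact pow_le_pow_left₀ h1.1 h2 2
      _ = ENNReal.ofReal ((η₁⁻¹) ^ 2) := by rw [lintegral_const, measure_univ, mul_one]
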